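/- **Setting.** For $x>0$ let $m(x)=x/10^{\lfloor\log_{10}x\rfloor}$ be its significand and $D_k(x)=\lfloor 10^{k-1}m(x)\rfloor-10\lfloor 10^{k-2}m(x)\rfloor$ its $k$-th significant digit. Let $P$ be the joint Benford law of $(D_1,D_2,D_3)$, i.e. $P(d_1,d_2,d_3)=\log_{10}(1+1/\delta)$ with $\delta=100d_1+10d_2+d_3$, for $d_1\in\{1,\dots,9\}$, $d_2,d_3\in\{0,\dots,9\}$. For $b>0$ and $N\ge 1$ let $P_N$ be the empirical joint law of $(D_1,D_2,D_3)$ along $b,b^2,\dots,b^N$. Both are vectors in $\mathbb R^{900}$ with Euclidean norm $\|\cdot\|_2$. Let $$F(p)=I(D_1;D_3\mid D_2)=H(D_1\mid D_2)-H(D_1\mid D_3,D_2)$$ be the conditional mutual information in bits of a joint law $p$ of $(D_1,D_2,D_3)$, where $H(D_1\mid D_2)=H(D_1,D_2)-H(D_2)$, $H(D_1\mid D_3,D_2)=H(D_1,D_2,D_3)-H(D_2,D_3)$ and $H$ is Shannon entropy in base $2$; by the same formula (with $-t\log_2 t$ summed over the entries of $p$ and of its marginals) $F$ is a function on a neighbourhood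 of $P$ in $\mathbb R^{900}$. Put $I_N=F(P_N)$, $I_\infty=F(P)$, and let $C_H=\tfrac12\|H_F(P)\|_{\mathrm{op}}$, where $H_F(P)$ is the Hessian of $F$ at $P$. Elsewhere $\log$ is the natural logarithm. **Theorem 3.7 (Rate characterization — upper bounds).** Let $b>0$ be real with $\alpha=\log_{10}b$ irrational, $\alpha=[a_0;a_1,a_2,\dots]$, and suppose $a_k\le M$ for all $k\ge1$. (a) For all $N\ge 2$, $$I_N-I_\infty\le C_1\,\frac{M\log N}{N}+C_2\,\frac{M^2(\log N)^2}{N^2},\qquad C_1=0.28\cdot 60,\quad C_2=C_H\cdot 3600 .$$ Moreover, as $N\to\infty$, $I_N-I_\infty=O\big(\tfrac{\log N}{N}\big)$, and $I_N-I_\infty=O(N^{-1+\varepsilon})$ for every $\varepsilon>0$. (b) (Conditional on quadratic scaling.) For $K>0$ say that quadratic scaling with constant $K$ holds at $(b,N)$ if $|I_N-I_\infty|\le K\|P_N-P\|_2^2$ or $|\nabla F(P)^{T}(P_N-P)|\le K\|P_N-P\|_2^2$. For every $K>0$ there is a constant $C_U>0$, depending only on $K$, such that for all $b$, $M$ as above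 and every $N\ge2$ for which quadratic scaling with constant $K$ holds at $(b,N)$, $$I_N-I_\infty\le C_U\,\frac{M^2(\log N)^2}{N^2}.$$ Moreover, for $b$, $M$ as above, if $S\subseteq\mathbb N$ and quadratic scaling with some constant $K$ holds at $(b,N)$ for all sufficiently large $N\in S$, then, as $N\to\infty$ in $S$, $I_N-I_\infty=O\big(\tfrac{(\log N)^2}{N^2}\big)$, and $I_N-I_\infty=O(N^{-2+\varepsilon})$ for every $\varepsilon>0$. -/

import Mathlib

open Filter Asymptotics

noncomputable section

/-- The significand `x / 10 ^ ⌊log₁₀ x⌋` of a positive real `x`. -/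
def significand (x : ℝ) : ℝ := x / (10 : ℝ) ^ ⌊Real.logb 10 x⌋

/-- The `k`-th significant decimal digit (`k ≥ 1`) of a positive real `x`. -/
def sigDigit (k : ℕ) (x : ℝ) : ℤ :=
  ⌊(10 : ℝ) ^ ((k : ℤ) - 1) * significand x⌋ - 10 * ⌊(10 : ℝ) ^ ((k : ℤ) - 2) * significand x⌋

/-- Digit triples. The triple `(i, j, k)` stands for `D₁ = i + 1`, `D₂ = j`, `D₃ = k`. -/
abbrev Triple : Type := Fin 9 × Fin 10 × Fin 10

/-- Real functions on the 900 digit triples, with the Euclidean norm. -/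
abbrev TripleFun : Type := EuclideanSpace ℝ Triple

/-- Joint Benford law: the triple `d₁d₂d₃`, read as the integer `δ = 100 d₁ + 10 d₂ + d₃`,
has probability `log₁₀ (1 + 1 / δ)`. -/
def benford : TripleFun :=
  WithLp.toLp 2 fun t : Triple =>
    Real.logb 10 (1 + 1 / (100 * ((t.1 : ℕ) + 1) + 10 * (t.2.1 : ℕ) + (t.2.2 : ℕ) : ℝ))

/-- Empirical law of the first three significant digits along `b, b², …, b^N`. -/
def empirical (b : ℝ) (N : ℕ) : TripleFun :=
  WithLp.toLp 2 fun t : Triple =>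
    (((Finset.Icc 1 N).filter fun n : ℕ =>
        sigDigit 1 (b ^ n) = (t.1 : ℕ) + 1 ∧ sigDigit 2 (b ^ n) = (t.2.1 : ℕ) ∧
          sigDigit 3 (b ^ n) = (t.2.2 : ℕ)).card : ℝ) / (N : ℝ)

/-- Shannon entropy in bits. -/
def entropy {ι : Type} [Fintype ι] (p : ι → ℝ) : ℝ := (∑ i, Real.negMulLog (p i)) / Real.log 2

/-- `H(D₁ | D₂) = H(D₁, D₂) - H(D₂)`. -/
def condEntropyD1D2 (p : TripleFun) : ℝ :=
  entropy (fun s : Fin 9 × Fin 10 => ∑ k, p (s.1, s.2, k)) -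
    entropy (fun j : Fin 10 => ∑ i, ∑ k, p (i, j, k))

/-- `H(D₁ | D₃, D₂) = H(D₁, D₂, D₃) - H(D₂, D₃)`. -/
def condEntropyD1D3D2 (p : TripleFun) : ℝ :=
  entropy (fun t : Triple => p t) -
    entropy (fun s : Fin 10 × Fin 10 => ∑ i, p (i, s.1, s.2))

/-- The conditional mutual information functional
`F(p) = I(D₁; D₃ | D₂) = H(D₁ | D₂) - H(D₁ | D₃, D₂)`. -/
def cmi (p : TripleFun) : ℝ := condEntropyD1D2 p - condEntropyD1D3D2 p

/-- `I_N`. -/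
def empiricalCMI (b : ℝ) (N : ℕ) : ℝ := cmi (empirical b N)

/-- `I_∞`. -/
def limitCMI : ℝ := cmi benford

/-- `C_H`, half the operator norm of the Hessian of `F` at the Benford law. -/
def hessConst : ℝ := ‖fderiv ℝ (fderiv ℝ cmi) benford‖ / 2

/-- The constant `C₁ = 0.28 · 60`. -/
def rateConst₁ : ℝ := 0.28 * 60

/-- The constant `C₂ = C_H · 3600`. -/
def rateConst₂ : ℝ := hessConst * 3600

/-- `a_k ≤ M` for all `k ≥ 1`, where `α = [a₀; a₁, a₂, …]`; the entry of index `n` of `partDens`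
is `a_{n+1}`. -/
def PartialQuotientsLE (α M : ℝ) : Prop :=
  ∀ (n : ℕ) (a : ℝ), (GenContFract.of α).partDens.get? n = some a → a ≤ M

/-- `|I_N - I_∞| ≤ K ‖P_N - P‖₂²` at the base `b` and the sample size `N`. -/
def QuadraticScaling (K b : ℝ) (N : ℕ) : Prop :=
  |empiricalCMI b N - limitCMI| ≤ K * ‖empirical b N - benford‖ ^ 2

/-- Suppression of the linear term, `|∇F(P)ᵀ (P_N - P)| ≤ K ‖P_N - P‖₂²`, at the base `b` and the
sample size `N`. -/
def LinearTermSuppressed (K b : ℝ) (N : ℕ) : Prop :=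
  |fderiv ℝ cmi benford (empirical b N - benford)| ≤ K * ‖empirical b N - benford‖ ^ 2

end

/-! The first three digits of `b ^ n` are determined by the fractional part of `n α`, so `P_N - P`
measures equidistribution on the logarithmic cells of the integers `δ` from 100 to 999. One function
`h` of the cell boundaries (`cellDiscr`) satisfies `(P_N - P)(t) = h(δ) - h(δ + 1)`, and everything
rests on its oscillation, which is at most `E = M (log₂ N + 1) / N`.

Discrepancy. Over a block whose length is a convergent denominator `q`, the points `n α` nearly form
a coset of `(1/q)ℤ`, and the counting error on any interval is at most 2 (`abs_block_sum_le`). A run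
of length `N` is cut into such blocks, or completed to one, and each reduction is charged to the
drop in `M log₂` of the run length (`abs_sum_run_le`).

Information. `F` is a signed sum of entropies of marginals, so `F(q) - F(p)` is exactly a linear
term plus relative entropies, with plus signs for `(D₁,D₂,D₃)` and `D₂` and minus signs for
`(D₁,D₂)` and `(D₂,D₃)` (`cmi_sub_cmi`). Since relative entropy lies between 0 and the chi-square
distance, the remainder is `O(E²)` for any law `q`, even one with zero entries; no Taylor estimate
near `P` is needed.

Constants. Summation by parts in each decade bounds the linear term by `5.8 E` nats, because its
weights are monotone in the third digit and change sign between digits 4 and 5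
(`abs_linTerm_benford_le`). The quadratic term costs `510795 E² log 10` nats (`chiSq_le`). The
Hessian norm occurs only in the allowed bound, so a lower bound for it suffices; one test direction
provides it (`hessConst_ge`).

For (b), the two-sided remainder estimate (`exists_abs_sub_fderiv_le`) and `‖P_N - P‖² ≤ 900 E²`
turn either form of quadratic scaling into an `O(E²)` bound, uniform in `b`, `M` and `N`. -/

/-! ### Convergents -/

/-- Denominators attached to a sequence of partial quotients, starting with `0, 1`. -/
def cfDen (A : ℕ → ℕ) : ℕ → ℕ
  | 0 => 0
  | 1 => 1
  | n + 2 => A n * cfDen A (n + 1) + cfDen A n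

/-- Numerators attached to an integer part and a sequence of partial quotients,
starting with `1, h`. -/
def cfNum (h : ℤ) (A : ℕ → ℕ) : ℕ → ℤ
  | 0 => 1
  | 1 => h
  | n + 2 => A n * cfNum h A (n + 1) + cfNum h A n

/-- The determinant identity, needed for coprimality of numerator and denominator. -/
theorem cfNum_mul_cfDen_sub (h : ℤ) (A : ℕ → ℕ) (n : ℕ) :
    cfNum h A n * cfDen A (n + 1) - cfDen A n * cfNum h A (n + 1) = (-1) ^ n := by
  induction n with
  | zero => simp [cfNum, cfDen]
  | succ n ih =>
    simp only [cfNum, cfDen, pow_succ] at ih ⊢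
    push_cast
    linear_combination (-1 : ℤ) * ih

theorem cfDen_pos {A : ℕ → ℕ} (hA : ∀ n, 1 ≤ A n) (n : ℕ) : 0 < cfDen A (n + 1) := by
  induction n with
  | zero => simp [cfDen]
  | succ n ih =>
    have := Nat.mul_le_mul (hA n) (le_refl (cfDen A (n + 1)))
    simp only [cfDen]
    omega

theorem cfDen_le_succ {A : ℕ → ℕ} (hA : ∀ n, 1 ≤ A n) (n : ℕ) :
    cfDen A n ≤ cfDen A (n + 1) := by
  cases n with
  | zero => simp [cfDen]
  | succ n =>
    have := Nat.mul_le_mul (hA n) (le_refl (cfDen A (n + 1)))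
    simp only [cfDen]
    omega

theorem le_cfDen_succ_succ {A : ℕ → ℕ} (hA : ∀ n, 1 ≤ A n) (n : ℕ) : n + 1 ≤ cfDen A (n + 2) := by
  induction n with
  | zero => exact cfDen_pos hA 1
  | succ n ih =>
    have h1 := Nat.mul_le_mul (hA (n + 1)) (le_refl (cfDen A (n + 2)))
    have h2 := cfDen_pos hA n
    have h3 : cfDen A (n + 1 + 2) = A (n + 1) * cfDen A (n + 2) + cfDen A (n + 1) := rfl
    omega

theorem exists_cfDen_le_lt {A : ℕ → ℕ} (hA : ∀ n, 1 ≤ A n) {N : ℕ} (hN : 1 ≤ N) :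
    ∃ k, cfDen A (k + 1) ≤ N ∧ N < cfDen A (k + 2) := by
  have hex : ∃ k, N < cfDen A (k + 2) := ⟨N, le_cfDen_succ_succ hA N⟩
  refine ⟨Nat.find hex, ?_, Nat.find_spec hex⟩
  rcases hk : Nat.find hex with _ | k
  · simpa [cfDen] using hN
  · have := Nat.find_min hex (m := k) (by omega)
    simpa using this

/-- The regular continued fraction of an irrational number whose partial quotients are at most `M`,
in integer terms. -/
theorem exists_cf_of_irrational {α M : ℝ} (hα : Irrational α) (hM : PartialQuotientsLE α M) :
    ∃ (h : ℤ) (A : ℕ → ℕ), (∀ n, 1 ≤ A n) ∧ (∀ n, (A n : ℝ) ≤ M) ∧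
      ∀ n, |α - cfNum h A (n + 1) / cfDen A (n + 1)| ≤
        1 / (cfDen A (n + 1) * cfDen A (n + 2)) := by
  have hnt : ∀ n, ¬(GenContFract.of α).TerminatedAt n := fun n hn =>
    let ⟨q, hq⟩ := (GenContFract.terminates_iff_rat α).1 ⟨n, hn⟩
    hα ⟨q, hq.symm⟩
  have hA : ∀ n, ∃ a : ℕ, 1 ≤ a ∧ (a : ℝ) ≤ M ∧
      (GenContFract.of α).s.get? n = some ⟨1, (a : ℝ)⟩ := by
    intro n
    obtain ⟨gp, hgp⟩ := Option.ne_none_iff_exists'.1 (hnt n)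
    obtain ⟨h1, z, hz⟩ := GenContFract.of_partNum_eq_one_and_exists_int_partDen_eq hgp
    have hpd : (GenContFract.of α).partDens.get? n = some gp.b :=
      GenContFract.partDen_eq_s_b hgp
    have h2 := GenContFract.of_one_le_get?_partDen hpd
    have h3 := hM n _ hpd
    have hz1 : 1 ≤ z := by rw [hz] at h2; exact_mod_cast h2
    obtain ⟨a, rfl⟩ := Int.eq_ofNat_of_zero_le (by omega : 0 ≤ z)
    refine ⟨a, by omega, by simpa [hz] using h3, ?_⟩
    rw [hgp]
    cases gp
    simp_all
  choose A hA1 hAM hAs using hA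
  have hc : ∀ n, (GenContFract.of α).contsAux n = ⟨(cfNum ⌊α⌋ A n : ℝ), (cfDen A n : ℝ)⟩ ∧
      (GenContFract.of α).contsAux (n + 1) =
        ⟨(cfNum ⌊α⌋ A (n + 1) : ℝ), (cfDen A (n + 1) : ℝ)⟩ := by
    intro n
    induction n with
    | zero => simp [cfNum, cfDen, GenContFract.contsAux, GenContFract.of_h_eq_floor]
    | succ n ih =>
      refine ⟨ih.2, ?_⟩
      rw [GenContFract.contsAux_recurrence (hAs n) ih.1 ih.2]
      simp [cfNum, cfDen]
  refine ⟨⌊α⌋, A, hA1, hAM, fun n => ?_⟩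
  have := GenContFract.abs_sub_convs_le (hnt n)
  have hd : ∀ n, (GenContFract.of α).dens n = cfDen A (n + 1) := fun n => by
    rw [GenContFract.den_eq_conts_b, GenContFract.nth_cont_eq_succ_nth_contAux, (hc n).2]
  have hn : ∀ n, (GenContFract.of α).nums n = cfNum ⌊α⌋ A (n + 1) := fun n => by
    rw [GenContFract.num_eq_conts_a, GenContFract.nth_cont_eq_succ_nth_contAux, (hc n).2]
  rwa [GenContFract.conv_eq_num_div_den, hn, hd, hd] at this

/-! ### Sums over runs of consecutive integers -/

theorem sum_range_add_mul_le {d : ℕ → ℝ} {q : ℕ} {C : ℝ}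
    (h : ∀ m, |∑ i ∈ Finset.range q, d (m + i)| ≤ C) (b m : ℕ) :
    |∑ i ∈ Finset.range (b * q), d (m + i)| ≤ b * C := by
  induction b with
  | zero => simp
  | succ b ih =>
    rw [Nat.succ_mul, Finset.sum_range_add]
    have := h (m + b * q)
    simp only [add_assoc] at this ⊢
    push_cast
    linarith [abs_add_le (∑ i ∈ Finset.range (b * q), d (m + i))
      (∑ i ∈ Finset.range q, d (m + (b * q + i)))]

/-- If the sums of `d` over runs of `cfDen A k` consecutive integers are at most `2`, then runs of
length `N` have sums of size at most `M (log₂ N + 1)`. -/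
theorem abs_sum_run_le {A : ℕ → ℕ} {M : ℝ} (hA : ∀ n, 1 ≤ A n) (hAM : ∀ n, (A n : ℝ) ≤ M)
    {d : ℕ → ℝ} (hd : ∀ n, |d n| ≤ 1)
    (hblock : ∀ k m, |∑ i ∈ Finset.range (cfDen A k), d (m + i)| ≤ 2) (N : ℕ) (hN : 1 ≤ N)
    (m : ℕ) : |∑ i ∈ Finset.range N, d (m + i)| ≤ M * (Real.logb 2 N + 1) := by
  have hM1 : 1 ≤ M := le_trans (by exact_mod_cast hA 0) (hAM 0)
  induction N using Nat.strong_induction_on generalizing m with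
  | _ N ih =>
  rcases Nat.lt_or_ge N 2 with hN2 | hN2
  · obtain rfl : N = 1 := by omega
    simpa using (hd m).trans hM1
  have hlogN : 1 ≤ Real.logb 2 N := by
    rw [Real.le_logb_iff_rpow_le (by norm_num) (by positivity)]
    simpa using (by exact_mod_cast hN2 : (2 : ℝ) ≤ N)
  -- reduction to a shorter run, at the cost `c`
  have key : ∀ (r : ℕ) (c : ℝ) (s : ℕ), 1 ≤ r → r < N → 2 ^ s * r ≤ N → c ≤ M * s →
      |∑ i ∈ Finset.range r, d (m + (N - r) + i)| + c ≤ M * (Real.logb 2 N + 1) ∧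
      |∑ i ∈ Finset.range r, d (m + N + i)| + c ≤ M * (Real.logb 2 N + 1) := by
    intro r c s hr hrN hs hc
    have h1 : (s : ℝ) + Real.logb 2 r ≤ Real.logb 2 N := by
      have hr0 : (0 : ℝ) < r := by exact_mod_cast hr
      have : Real.logb 2 (2 ^ s * r) ≤ Real.logb 2 N :=
        Real.logb_le_logb_of_le (by norm_num) (by positivity) (by exact_mod_cast hs)
      rwa [Real.logb_mul (by positivity) hr0.ne', Real.logb_pow, Real.logb_self_eq_one (by norm_num),
        mul_one] at this
    have h2 : M * (s + Real.logb 2 r) ≤ M * Real.logb 2 N :=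
      mul_le_mul_of_nonneg_left h1 (by linarith)
    constructor
    · linarith [ih r hrN hr (m + (N - r))]
    · linarith [ih r hrN hr (m + N)]
  obtain ⟨k, hk1, hk2⟩ := exists_cfDen_le_lt hA hN
  have hqrec : cfDen A (k + 2) = A k * cfDen A (k + 1) + cfDen A k := rfl
  have hqpos := cfDen_pos hA k
  have hq' := cfDen_le_succ hA k
  -- complement in a block of length `cfDen A (k + 2)`
  have compl : ∀ r, r + N = cfDen A (k + 2) → 1 ≤ r → r < N → ∀ s : ℕ, 2 ^ s * r ≤ N →
      2 ≤ M * s → |∑ i ∈ Finset.range N, d (m + i)| ≤ M * (Real.logb 2 N + 1) := by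
    intro r hr hr1 hrN s hs hMs
    have h1 := hblock (k + 2) m
    rw [← hr, add_comm, Finset.sum_range_add] at h1
    have h2 := (key r 2 s hr1 hrN hs hMs).2
    simp only [add_assoc] at h1 h2
    have h3 := abs_sub (∑ i ∈ Finset.range N, d (m + i) + ∑ i ∈ Finset.range r, d (m + (N + i)))
      (∑ i ∈ Finset.range r, d (m + (N + i)))
    rw [add_sub_cancel_right] at h3
    linarith
  set q := cfDen A (k + 1) with hq
  set q' := cfDen A k with hqq'
  -- Greedy division: removing `b` blocks of length `q` costs `2 b`. Passing from `N` to `r` with `2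
  -- ^ s * r ≤ N` saves `M s`, so the cases below look for an `s` that pays the cost; where direct
  -- removal is too dear, completing to a block of length `cfDen A (k + 2)` costs only 2.
  obtain ⟨b, r, hr, hNbr⟩ : ∃ b r, r < q ∧ N = b * q + r :=
    ⟨N / q, N % q, Nat.mod_lt _ hqpos, (Nat.div_add_mod' N q).symm⟩
  have hbA : b ≤ A k := by
    by_contra hcon
    have := Nat.mul_le_mul (Nat.lt_of_not_le hcon) (le_refl q)
    rw [Nat.succ_mul] at this
    omega
  have hb1 : 1 ≤ b := by
    by_contra hcon
    obtain rfl : b = 0 := by omega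
    omega
  have hbM : (b : ℝ) ≤ M := le_trans (by exact_mod_cast hbA) (hAM k)
  have hblocks := sum_range_add_mul_le (hblock (k + 1)) b m
  rw [← hq] at hblocks
  rcases Nat.eq_zero_or_pos r with rfl | hr0
  · rw [add_zero] at hNbr
    rw [← hNbr] at hblocks
    nlinarith
  have direct : ∀ s : ℕ, 2 ^ s * r ≤ N → 2 * (b : ℝ) ≤ M * s →
      |∑ i ∈ Finset.range N, d (m + i)| ≤ M * (Real.logb 2 N + 1) := by
    intro s hs hc
    have hbq : q ≤ b * q := Nat.le_mul_of_pos_left q hb1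
    have h2 := (key r (2 * b) s hr0 (by omega) hs hc).1
    rw [show N - r = b * q by omega] at h2
    have h3 : ∑ i ∈ Finset.range N, d (m + i) = ∑ i ∈ Finset.range (b * q), d (m + i) +
        ∑ i ∈ Finset.range r, d (m + b * q + i) := by
      rw [hNbr, Finset.sum_range_add]
      simp only [add_assoc]
    rw [h3]
    linarith [abs_add_le (∑ i ∈ Finset.range (b * q), d (m + i))
      (∑ i ∈ Finset.range r, d (m + b * q + i))]
  rcases lt_or_ge M 2 with hM2 | hM2
  -- The golden-ratio tail: `M` may be as small as 1, so a cost of 2 requires shrinking by a factor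
  -- 4.
  · have hA1 : ∀ n, A n = 1 := fun n => by
      have h1 : (A n : ℝ) < 2 := (hAM n).trans_lt hM2
      have h2 : A n < 2 := by exact_mod_cast h1
      have h3 := hA n
      omega
    have hAk := hA1 k
    rw [hAk] at hbA hqrec
    obtain rfl : b = 1 := by omega
    -- For Fibonacci denominators `3 q' ≤ 2 q`, since two steps back in the sequence at most one
    -- doubling separates neighbours; for `k < 2` one has `q = 1`, which contradicts `0 < r < q`.
    have hge : q' + q' ≤ 2 * q - q' ∧ 2 ≤ k := by
      rcases hk' : k with _ | _ | k
      · rw [hk'] at hqq' hq; simp [cfDen] at hq hqq'; omega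
      · rw [hk'] at hqq' hq; simp [cfDen] at hq hqq'; omega
      · rw [hk'] at hqq' hq
        have e1 : cfDen A (k + 2 + 1) = A (k + 1) * cfDen A (k + 2) + cfDen A (k + 1) := rfl
        have e2 : cfDen A (k + 2) = A k * cfDen A (k + 1) + cfDen A k := rfl
        have e3 := cfDen_le_succ hA k
        rw [hA1] at e1 e2
        simp only [add_assoc, Nat.reduceAdd] at hq hqq' e1 e2
        omega
    -- Here `r < q'`, and either `r` or its complement `q' - r` is at most `q' / 2`, hence at most
    -- `N / 4`.
    rcases Nat.lt_or_ge q' (2 * r) with hr2 | hr2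
    · exact compl (q + q' - N) (by omega) (by omega) (by omega) 2 (by omega)
        (by push_cast; linarith)
    · exact direct 2 (by omega) (by push_cast; linarith)
  · rcases (by omega : b = 1 ∨ b = 2 ∨ 3 ≤ b) with rfl | rfl | hb3
    · exact direct 1 (by omega) (by push_cast; linarith)
    · rcases Nat.lt_or_ge (A k) 3 with hA3 | hA3
      · have hAk : A k = 2 := by omega
        rw [hAk] at hqrec
        exact compl (2 * q + q' - N) (by omega) (by omega) (by omega) 1 (by omega)
          (by push_cast; linarith)
      · -- here `N ≥ 3 r`, and `3 ^ 3 ≥ 2 ^ 4`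
        have hM3 : (3 : ℝ) ≤ M := le_trans (by exact_mod_cast hA3) (hAM k)
        have hr0' : (0 : ℝ) < r := by exact_mod_cast hr0
        have h1 : (4 : ℝ) / 3 + Real.logb 2 r ≤ Real.logb 2 N := by
          have h3N : (3 : ℝ) * r ≤ N := by exact_mod_cast (by omega : 3 * r ≤ N)
          have h4 : Real.logb 2 (3 * r) ≤ Real.logb 2 N :=
            Real.logb_le_logb_of_le (by norm_num) (by positivity) h3N
          rw [Real.logb_mul (by norm_num) hr0'.ne'] at h4
          have h5 : Real.logb 2 (2 ^ 4) ≤ Real.logb 2 ((3 : ℝ) ^ 3) :=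
            Real.logb_le_logb_of_le (by norm_num) (by positivity) (by norm_num)
          rw [Real.logb_pow, Real.logb_pow, Real.logb_self_eq_one (by norm_num)] at h5
          push_cast at h5
          linarith
        have h2 := ih r (by omega) hr0 (m + 2 * q)
        have h3 : ∑ i ∈ Finset.range N, d (m + i) = ∑ i ∈ Finset.range (2 * q), d (m + i) +
            ∑ i ∈ Finset.range r, d (m + 2 * q + i) := by
          rw [hNbr, Finset.sum_range_add]
          simp only [add_assoc]
        rw [h3]
        have h4 := abs_add_le (∑ i ∈ Finset.range (2 * q), d (m + i))
          (∑ i ∈ Finset.range r, d (m + 2 * q + i))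
        push_cast at hblocks
        nlinarith
    -- With `b ≥ 3` one has `N > 4 r`, and the cost `2 b ≤ 2 M` is met by `s = 2`.
    · refine direct 2 ?_ (by push_cast; linarith)
      have := Nat.mul_le_mul hb3 (le_refl q)
      omega

/-! ### Floor sums over a full period and the discrepancy of `n α`. -/

theorem sum_range_comp_add {f : ℕ → ℝ} {q : ℕ} (hf : ∀ i, f (i + q) = f i) (j : ℕ) :
    ∑ i ∈ Finset.range q, f (i + j) = ∑ i ∈ Finset.range q, f i := by
  induction j with
  | zero => simp
  | succ j ih =>
    rw [← ih]
    have h := Finset.sum_range_succ_sub_sum (fun i => f (i + j)) (n := q)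
    have h2 := Finset.sum_range_succ' (fun i => f (i + j)) q
    have h3 : f (q + j) = f (0 + j) := by rw [add_comm q j, hf, zero_add]
    rw [h3] at h
    have h4 : ∑ i ∈ Finset.range q, f (i + (j + 1)) = ∑ i ∈ Finset.range q, f (i + 1 + j) :=
      Finset.sum_congr rfl fun i _ => by rw [add_right_comm, add_assoc]
    linarith

/-- `∑ ⌊w + i p / q⌋` over a full period. -/
noncomputable def floorSum (p : ℤ) (q : ℕ) (w : ℝ) : ℤ := ∑ i ∈ Finset.range q, ⌊w + i * (p / q : ℝ)⌋

theorem floorSum_mono (p : ℤ) (q : ℕ) : Monotone (floorSum p q) := fun _ _ h =>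
  Finset.sum_le_sum fun _ _ => Int.floor_le_floor (by linarith)

/-- As `p` is invertible modulo `q`, raising `w` by `1 / q` only permutes the fractional parts, so
their sum is unchanged while the sum of the arguments grows by 1. -/
theorem floorSum_add_inv {p : ℤ} {q : ℕ} (hq : 0 < q) (hpq : IsCoprime p q) (w : ℝ) :
    floorSum p q (w + 1 / q) = floorSum p q w + 1 := by
  have hq0 : (q : ℝ) ≠ 0 := by positivity
  -- `j` inverts `p` modulo `q`: shifting the index by `j` adds `1 / q` up to an integer.
  obtain ⟨j, t, hj⟩ : ∃ (j : ℕ) (t : ℤ), (j : ℤ) * p = 1 + t * q := by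
    obtain ⟨a, c, hac⟩ := hpq
    refine ⟨(a % q).toNat, -c - a / q * p, ?_⟩
    rw [Int.toNat_of_nonneg (Int.emod_nonneg _ (by omega))]
    have := Int.emod_add_mul_ediv a q
    linear_combination hac + p * this
  have hj' : (j : ℝ) * p = 1 + t * q := by exact_mod_cast hj
  have h1 : ∑ i ∈ Finset.range q, Int.fract (w + ((i + j : ℕ) : ℝ) * (p / q : ℝ)) =
      ∑ i ∈ Finset.range q, Int.fract (w + (i : ℝ) * (p / q : ℝ)) := by
    refine sum_range_comp_add (f := fun i : ℕ => Int.fract (w + (i : ℝ) * (p / q : ℝ)))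
      (fun i => ?_) j
    have : w + ((i + q : ℕ) : ℝ) * (p / q : ℝ) = w + (i : ℝ) * (p / q : ℝ) + p := by
      push_cast
      field_simp
      ring
    simp only [this, Int.fract_add_intCast]
  have h2 : ∑ i ∈ Finset.range q, Int.fract (w + ((i + j : ℕ) : ℝ) * (p / q : ℝ)) =
      ∑ i ∈ Finset.range q, Int.fract (w + 1 / q + (i : ℝ) * (p / q : ℝ)) := by
    refine Finset.sum_congr rfl fun i _ => ?_
    have : w + ((i + j : ℕ) : ℝ) * (p / q : ℝ) = w + 1 / q + (i : ℝ) * (p / q : ℝ) + t := by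
      push_cast
      field_simp
      linear_combination hj'
    rw [this, Int.fract_add_intCast]
  have h3 : ∑ i ∈ Finset.range q, (w + 1 / q + (i : ℝ) * (p / q : ℝ)) =
      ∑ i ∈ Finset.range q, (w + (i : ℝ) * (p / q : ℝ)) + 1 := by
    simp only [Finset.sum_add_distrib, Finset.sum_const, Finset.card_range, nsmul_eq_mul,
      mul_one_div_cancel hq0]
    ring
  have h4 : (floorSum p q (w + 1 / q) : ℝ) = floorSum p q w + 1 := by
    simp only [floorSum, Int.cast_sum]
    simp only [← Int.self_sub_fract, Finset.sum_sub_distrib]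
    linarith
  exact_mod_cast h4

theorem floorSum_add_int_div {p : ℤ} {q : ℕ} (hq : 0 < q) (hpq : IsCoprime p q) (w : ℝ) (j : ℤ) :
    floorSum p q (w + j / q) = floorSum p q w + j := by
  induction j with
  | zero => simp
  | succ j ih =>
    rw [← add_assoc, ← ih, ← floorSum_add_inv hq hpq]
    congr 1
    push_cast
    ring
  | pred j ih =>
    have := floorSum_add_inv hq hpq (w + ((-j - 1 : ℤ) : ℝ) / q)
    rw [show w + ((-j - 1 : ℤ) : ℝ) / q + 1 / q = w + ((-j : ℤ) : ℝ) / q by push_cast; ring,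
      ih] at this
    linarith

/-- A monotone function that gains exactly 1 over each step `1 / q` stays within 1 of slope `q`. -/
theorem abs_floorSum_sub_le {p : ℤ} {q : ℕ} (hq : 0 < q) (hpq : IsCoprime p q) (w z : ℝ) :
    |((floorSum p q z - floorSum p q w : ℤ) : ℝ) - q * (z - w)| ≤ 1 := by
  have hq0 : (0 : ℝ) < q := by positivity
  have h1 := Int.floor_le (q * (z - w))
  have h2 := Int.lt_floor_add_one (q * (z - w))
  have h3 : floorSum p q w + ⌊q * (z - w)⌋ ≤ floorSum p q z := by
    rw [← floorSum_add_int_div hq hpq]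
    refine floorSum_mono p q ?_
    have : (⌊q * (z - w)⌋ : ℝ) / q ≤ z - w := by rw [div_le_iff₀ hq0]; linarith
    linarith
  have h4 : floorSum p q z ≤ floorSum p q w + (⌊q * (z - w)⌋ + 1) := by
    rw [← floorSum_add_int_div hq hpq]
    refine floorSum_mono p q ?_
    have : z - w ≤ ((⌊q * (z - w)⌋ + 1 : ℤ) : ℝ) / q := by
      rw [le_div_iff₀ hq0]; push_cast; linarith
    linarith
  have h3' : (floorSum p q w : ℝ) + ⌊q * (z - w)⌋ ≤ floorSum p q z := by exact_mod_cast h3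
  have h4' : (floorSum p q z : ℝ) ≤ floorSum p q w + (⌊q * (z - w)⌋ + 1) := by exact_mod_cast h4
  push_cast
  rw [abs_le]
  constructor <;> linarith

/-- Along a full period of a good rational approximation, the sum of `⌊z + i α⌋` is known up to one
unit. -/
theorem exists_floorSum_le_sum_floor_le {α : ℝ} {p : ℤ} {q : ℕ} (hq : 0 < q) (hpq : IsCoprime p q)
    (hα : |α - p / q| ≤ 1 / (q * q)) :
    ∃ c : ℤ, ∀ z : ℝ, floorSum p q z + c ≤ ∑ i ∈ Finset.range q, ⌊z + i * α⌋ ∧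
      ∑ i ∈ Finset.range q, ⌊z + i * α⌋ ≤ floorSum p q z + c + 1 := by
  have hq0 : (0 : ℝ) < q := by positivity
  obtain ⟨hl, hu⟩ := abs_le.1 hα
  have hbd : ∀ i ∈ Finset.range q, (i : ℝ) * (1 / (q * q)) ≤ 1 / q := by
    intro i hi
    have : (i : ℝ) ≤ q := by exact_mod_cast (Finset.mem_range.1 hi).le
    calc (i : ℝ) * (1 / (q * q)) ≤ q * (1 / (q * q)) := by gcongr
      _ = 1 / q := by field_simp
  -- Replacing `p / q` by `α` moves every argument one way by at most `1 / q`, and a shift by `1 /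
  -- q` changes `floorSum` by 1. The constant `c` records the side of `α` and does not depend on
  -- `z`.
  rcases le_total (p / q : ℝ) α with h | h
  · refine ⟨0, fun z => ⟨?_, ?_⟩⟩
    · rw [add_zero]
      refine Finset.sum_le_sum fun i _ => Int.floor_le_floor ?_
      gcongr
    · rw [add_zero, ← floorSum_add_inv hq hpq]
      refine Finset.sum_le_sum fun i hi => Int.floor_le_floor ?_
      have h1 : (i : ℝ) * (α - p / q) ≤ i * (1 / (q * q)) := by gcongr
      have h2 := hbd i hi
      linarith
  · refine ⟨-1, fun z => ⟨?_, ?_⟩⟩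
    · have h0 := floorSum_add_inv hq hpq (z - 1 / q)
      rw [sub_add_cancel] at h0
      rw [h0, add_neg_cancel_right]
      refine Finset.sum_le_sum fun i hi => Int.floor_le_floor ?_
      have h1 : (i : ℝ) * (p / q - α) ≤ i * (1 / (q * q)) :=
        mul_le_mul_of_nonneg_left (by linarith) (by positivity)
      have h2 := hbd i hi
      linarith
    · rw [neg_add_cancel_right]
      refine Finset.sum_le_sum fun i _ => Int.floor_le_floor ?_
      gcongr

theorem abs_floor_sub_floor_sub_le (x u v : ℝ) :
    |((⌊x - u⌋ - ⌊x - v⌋ : ℤ) : ℝ) - (v - u)| ≤ 1 := by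
  have h1 := Int.floor_le (x - u)
  have h2 := Int.lt_floor_add_one (x - u)
  have h3 := Int.floor_le (x - v)
  have h4 := Int.lt_floor_add_one (x - v)
  push_cast
  rw [abs_le]
  constructor <;> linarith

/-- One unit comes from the rational rotation and one from replacing `p / q` by `α`. The common
constant `c` cancels between the two endpoints, which keeps the bound at 2. -/
theorem abs_block_sum_le {α : ℝ} {p : ℤ} {q : ℕ} (hq : 0 < q) (hpq : IsCoprime p q)
    (hα : |α - p / q| ≤ 1 / (q * q)) (u v x : ℝ) :
    |∑ i ∈ Finset.range q, (((⌊x + i * α - u⌋ - ⌊x + i * α - v⌋ : ℤ) : ℝ) - (v - u))| ≤ 2 := by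
  obtain ⟨c, hc⟩ := exists_floorSum_le_sum_floor_le hq hpq hα
  have hu := hc (x - u)
  have hv := hc (x - v)
  have h := abs_le.1 (abs_floorSum_sub_le hq hpq (x - v) (x - u))
  have e : ∑ i ∈ Finset.range q, (((⌊x + i * α - u⌋ - ⌊x + i * α - v⌋ : ℤ) : ℝ) - (v - u)) =
      ((∑ i ∈ Finset.range q, ⌊x - u + i * α⌋ : ℤ) : ℝ) -
        ((∑ i ∈ Finset.range q, ⌊x - v + i * α⌋ : ℤ) : ℝ) - q * (v - u) := by
    rw [Finset.sum_sub_distrib, Finset.sum_const, Finset.card_range, nsmul_eq_mul]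
    push_cast
    rw [Finset.sum_sub_distrib]
    simp only [sub_add_eq_add_sub]
  rw [e]
  have hu1 : (floorSum p q (x - u) : ℝ) + c ≤
    ((∑ i ∈ Finset.range q, ⌊x - u + i * α⌋ : ℤ) : ℝ) := by exact_mod_cast hu.1
  have hu2 : ((∑ i ∈ Finset.range q, ⌊x - u + i * α⌋ : ℤ) : ℝ) ≤
    (floorSum p q (x - u) : ℝ) + c + 1 := by exact_mod_cast hu.2
  have hv1 : (floorSum p q (x - v) : ℝ) + c ≤
    ((∑ i ∈ Finset.range q, ⌊x - v + i * α⌋ : ℤ) : ℝ) := by exact_mod_cast hv.1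
  have hv2 : ((∑ i ∈ Finset.range q, ⌊x - v + i * α⌋ : ℤ) : ℝ) ≤
    (floorSum p q (x - v) : ℝ) + c + 1 := by exact_mod_cast hv.2
  push_cast at h hu1 hu2 hv1 hv2 ⊢
  rw [abs_le]
  constructor <;> linarith [h.1, h.2]

theorem one_le_of_partialQuotientsLE {α M : ℝ} (hα : Irrational α)
    (hM : PartialQuotientsLE α M) : 1 ≤ M := by
  obtain ⟨h, A, hA, hAM, -⟩ := exists_cf_of_irrational hα hM
  exact le_trans (by exact_mod_cast hA 0) (hAM 0)

/-- Discrepancy of `n ↦ n α` for `α` with partial quotients at most `M`. -/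
theorem abs_sum_floor_sub_le {α M : ℝ} (hα : Irrational α) (hM : PartialQuotientsLE α M)
    {N : ℕ} (hN : 1 ≤ N) (u v : ℝ) :
    |∑ n ∈ Finset.Icc 1 N, ((⌊n * α - u⌋ : ℝ) - ⌊n * α - v⌋) - N * (v - u)| ≤
      M * (Real.logb 2 N + 1) := by
  obtain ⟨h, A, hA, hAM, happ⟩ := exists_cf_of_irrational hα hM
  have hcop : ∀ n, IsCoprime (cfNum h A (n + 1)) (cfDen A (n + 1) : ℤ) := by
    intro n
    have := cfNum_mul_cfDen_sub h A n
    have hs : ((-1 : ℤ) ^ n) * (-1) ^ n = 1 := by rw [← mul_pow]; simp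
    exact ⟨-(-1) ^ n * cfDen A n, (-1) ^ n * cfNum h A n, by linear_combination (-1) ^ n * this + hs⟩
  set d : ℕ → ℝ := fun n =>
    ((⌊(n + 1 : ℕ) * α - u⌋ - ⌊(n + 1 : ℕ) * α - v⌋ : ℤ) : ℝ) - (v - u) with hd
  have hmain := abs_sum_run_le hA hAM (d := d)
    (fun n => abs_floor_sub_floor_sub_le _ _ _) (fun k m => ?_) N hN 0
  · have e : ∑ n ∈ Finset.Icc 1 N, ((⌊n * α - u⌋ : ℝ) - ⌊n * α - v⌋) - N * (v - u) =
        ∑ i ∈ Finset.range N, d (0 + i) := by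
      rw [← Finset.Ico_add_one_right_eq_Icc, Finset.sum_Ico_eq_sum_range]
      simp only [hd, Finset.sum_sub_distrib, Finset.sum_const, Finset.card_range, nsmul_eq_mul,
        Int.cast_sub, Nat.add_sub_cancel, zero_add]
      simp only [add_comm 1]
      ring
    rwa [e]
  · rcases k with _ | k
    · simp [cfDen]
    have hq := cfDen_pos hA k
    have hq0 : (0 : ℝ) < cfDen A (k + 1) := by exact_mod_cast hq
    have hle : (cfDen A (k + 1) : ℝ) ≤ cfDen A (k + 2) := by
      exact_mod_cast cfDen_le_succ hA (k + 1)
    have := abs_block_sum_le hq (hcop k) ((happ k).trans (by gcongr)) u v ((m + 1 : ℕ) * α)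
    convert this using 4 with i
    have : ((m + i + 1 : ℕ) : ℝ) * α = (m + 1 : ℕ) * α + i * α := by push_cast; ring
    rw [this]

/-! ### Digits and discrepancy -/

/-- The three-digit integer `100 d₁ + 10 d₂ + d₃` of a digit triple. -/
def Triple.code (t : Triple) : ℕ := 100 * (t.1 + 1) + 10 * t.2.1 + t.2.2

/-- `log₁₀ (δ / 100)`, the left end of the cell of `δ` on the logarithmic scale. -/
noncomputable def cellStart (δ : ℕ) : ℝ := Real.logb 10 (δ / 100)

theorem cellStart_mono {δ ε : ℕ} (hδ : 0 < δ) (h : δ ≤ ε) : cellStart δ ≤ cellStart ε := by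
  have : (0 : ℝ) < δ := by exact_mod_cast hδ
  exact Real.logb_le_logb_of_le (by norm_num) (by positivity) (by gcongr)

theorem cellStart_hundred : cellStart 100 = 0 := by norm_num [cellStart]

theorem cellStart_thousand : cellStart 1000 = 1 := by norm_num [cellStart]

theorem cellStart_succ_sub {δ : ℕ} (hδ : 0 < δ) :
    cellStart (δ + 1) - cellStart δ = Real.logb 10 (1 + 1 / δ) := by
  have : (0 : ℝ) < δ := by exact_mod_cast hδ
  rw [cellStart, cellStart, ← Real.logb_div (by positivity) (by positivity)]
  congr 1
  push_cast
  field_simp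

theorem Triple.hundred_le_code (t : Triple) : 100 ≤ t.code := by simp only [Triple.code]; omega

theorem Triple.code_lt (t : Triple) : t.code < 1000 := by simp only [Triple.code]; omega

theorem benford_apply (t : Triple) : benford t = Real.logb 10 (1 + 1 / t.code) := by
  simp [benford, Triple.code]

theorem benford_eq_sub (t : Triple) :
    benford t = cellStart (t.code + 1) - cellStart t.code := by
  rw [cellStart_succ_sub (by linarith [t.hundred_le_code]), benford_apply]

/-- Floors linearise the count of visits to `[u, v)`, so the two endpoints can be treated
separately. -/
theorem floor_sub_sub_floor_sub_eq_ite {x u v : ℝ} (hu : 0 ≤ u) (huv : u ≤ v) (hv : v ≤ 1) :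
    (⌊x - u⌋ : ℝ) - ⌊x - v⌋ = if u ≤ Int.fract x ∧ Int.fract x < v then 1 else 0 := by
  have h0 := Int.fract_nonneg x
  have h1 := Int.fract_lt_one x
  have hx := Int.floor_add_fract x
  have key : ∀ y : ℝ, 0 ≤ y → y ≤ 1 →
      (⌊x - y⌋ : ℝ) = ⌊x⌋ + if y ≤ Int.fract x then 0 else -1 := by
    intro y hy0 hy1
    split_ifs with h
    · have : ⌊x - y⌋ = ⌊x⌋ := by
        rw [Int.floor_eq_iff]
        constructor <;> linarith
      rw [this, add_zero]
    · have : ⌊x - y⌋ = ⌊x⌋ - 1 := by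
        rw [Int.floor_eq_iff]
        push_cast
        constructor <;> linarith
      rw [this]
      push_cast
      ring
  rw [key u hu (huv.trans hv), key v (hu.trans huv) hv]
  by_cases h2 : u ≤ Int.fract x <;> by_cases h3 : v ≤ Int.fract x
  · simp [h2, h3]
  · simp [h2, h3, not_le.1 h3]
  · exact absurd (huv.trans h3) h2
  · simp [h2, h3]

theorem significand_pow {b : ℝ} (hb : 0 < b) (n : ℕ) :
    significand (b ^ n) = (10 : ℝ) ^ Int.fract (n * Real.logb 10 b) := by
  have h1 : b ^ n = (10 : ℝ) ^ (n * Real.logb 10 b) := by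
    rw [mul_comm, Real.rpow_mul (by norm_num), Real.rpow_logb (by norm_num) (by norm_num) hb,
      Real.rpow_natCast]
  rw [significand, Real.logb_pow, h1, ← Real.rpow_intCast, ← Real.rpow_sub (by norm_num),
    Int.self_sub_floor]

theorem digits_eq_iff {x : ℝ} (h1 : 1 ≤ significand x) (h10 : significand x < 10) (t : Triple) :
    (sigDigit 1 x = (t.1 : ℕ) + 1 ∧ sigDigit 2 x = (t.2.1 : ℕ) ∧ sigDigit 3 x = (t.2.2 : ℕ)) ↔
      (t.code : ℝ) ≤ 100 * significand x ∧ 100 * significand x < t.code + 1 := by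
  set s := significand x with hs
  have e1 : sigDigit 1 x = ⌊s⌋ := by
    have : ⌊(10 : ℝ) ^ (-1 : ℤ) * s⌋ = 0 := by
      rw [Int.floor_eq_iff]
      norm_num
      constructor <;> linarith
    rw [sigDigit, ← hs, show ((1 : ℕ) : ℤ) - 2 = -1 by norm_num, this]
    simp
  have e2 : sigDigit 2 x = ⌊10 * s⌋ - 10 * ⌊s⌋ := by
    norm_num [sigDigit, ← hs]
  have e3 : sigDigit 3 x = ⌊100 * s⌋ - 10 * ⌊10 * s⌋ := by
    norm_num [sigDigit, ← hs]
  have f1 : ⌊10 * s⌋ = ⌊100 * s⌋ / 10 := by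
    have := Int.floor_div_natCast (100 * s) 10
    rw [← Nat.cast_ofNat (R := ℤ), ← this]
    congr 1
    push_cast
    ring
  have f2 : ⌊s⌋ = ⌊100 * s⌋ / 100 := by
    have := Int.floor_div_natCast (100 * s) 100
    rw [← Nat.cast_ofNat (R := ℤ), ← this]
    congr 1
    push_cast
    ring
  have hfl : ((t.code : ℝ) ≤ 100 * s ∧ 100 * s < t.code + 1) ↔ ⌊100 * s⌋ = t.code := by
    rw [Int.floor_eq_iff]
    push_cast
    rfl
  rw [hfl, e1, e2, e3, f1, f2, Triple.code]
  push_cast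
  omega

theorem cellStart_le_iff {δ : ℕ} (hδ : 0 < δ) (y : ℝ) :
    cellStart δ ≤ y ↔ (δ : ℝ) ≤ 100 * (10 : ℝ) ^ y := by
  have : (0 : ℝ) < δ := by exact_mod_cast hδ
  rw [cellStart, Real.logb_le_iff_le_rpow (by norm_num) (by positivity), div_le_iff₀ (by norm_num),
    mul_comm]

/-- The signed discrepancy of the first `N` multiples of `log₁₀ b` at the left end of the cell of
`δ`, up to a term independent of `δ`. -/
noncomputable def cellDiscr (b : ℝ) (N δ : ℕ) : ℝ :=
  (∑ n ∈ Finset.Icc 1 N, (⌊n * Real.logb 10 b - cellStart δ⌋ : ℝ)) / N + cellStart δ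

theorem empirical_apply {b : ℝ} (hb : 0 < b) (N : ℕ) (t : Triple) :
    empirical b N t = (∑ n ∈ Finset.Icc 1 N, ((⌊n * Real.logb 10 b - cellStart t.code⌋ : ℝ) -
      ⌊n * Real.logb 10 b - cellStart (t.code + 1)⌋)) / N := by
  have hc := t.hundred_le_code
  have hc2 := t.code_lt
  simp only [empirical]
  rw [Finset.card_filter]
  push_cast
  congr 1
  refine Finset.sum_congr rfl fun n _ => ?_
  have h0 : 0 ≤ cellStart t.code := by
    rw [← cellStart_hundred]; exact cellStart_mono (by norm_num) hc
  have h1 : cellStart (t.code + 1) ≤ 1 := by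
    rw [← cellStart_thousand]; exact cellStart_mono (by omega) hc2
  rw [floor_sub_sub_floor_sub_eq_ite h0 (cellStart_mono (by omega) (by omega)) h1]
  refine if_congr ?_ rfl rfl
  have hs := significand_pow hb n
  set y := Int.fract (n * Real.logb 10 b) with hy
  have hy0 : 0 ≤ y := Int.fract_nonneg _
  have hy1 : y < 1 := Int.fract_lt_one _
  have hlt := (cellStart_le_iff (δ := t.code + 1) (by omega) y).not
  rw [not_le, not_le] at hlt
  push_cast at hlt
  rw [digits_eq_iff, cellStart_le_iff (by omega), hs]
  · exact and_congr_right fun _ => hlt.symm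
  · rw [hs]; exact Real.one_le_rpow (by norm_num) hy0
  · rw [hs]; exact Real.rpow_lt_self_of_one_lt (by norm_num) hy1

/-- The telescoping form is what matters: sums over consecutive cells are again single differences
of `cellDiscr`, with no loss in the bound. -/
theorem empirical_sub_benford_apply {b : ℝ} (hb : 0 < b) (N : ℕ) (t : Triple) :
    (empirical b N - benford) t = cellDiscr b N t.code - cellDiscr b N (t.code + 1) := by
  rw [PiLp.sub_apply, empirical_apply hb, benford_eq_sub, cellDiscr, cellDiscr,
    Finset.sum_sub_distrib]
  ring

theorem abs_cellDiscr_sub_le {b M : ℝ} (hα : Irrational (Real.logb 10 b))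
    (hM : PartialQuotientsLE (Real.logb 10 b) M) {N : ℕ} (hN : 1 ≤ N) (δ ε : ℕ) :
    |cellDiscr b N δ - cellDiscr b N ε| ≤ M * (Real.logb 2 N + 1) / N := by
  have hN0 : (0 : ℝ) < N := by exact_mod_cast hN
  have := abs_sum_floor_sub_le hα hM hN (cellStart δ) (cellStart ε)
  have e : cellDiscr b N δ - cellDiscr b N ε =
      (∑ n ∈ Finset.Icc 1 N, ((⌊n * Real.logb 10 b - cellStart δ⌋ : ℝ) -
        ⌊n * Real.logb 10 b - cellStart ε⌋) - N * (cellStart ε - cellStart δ)) / N := by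
    rw [cellDiscr, cellDiscr, Finset.sum_sub_distrib, sub_div, mul_div_cancel_left₀ _ hN0.ne']
    ring
  rw [e, abs_div, abs_of_pos hN0]
  gcongr

theorem empirical_nonneg (b : ℝ) (N : ℕ) (t : Triple) : 0 ≤ empirical b N t := by
  simp only [empirical]
  positivity

theorem benford_pos (t : Triple) : 0 < benford t := by
  have : (0 : ℝ) < t.code := by exact_mod_cast (by linarith [t.hundred_le_code] : 0 < t.code)
  rw [benford_apply]
  exact Real.logb_pos (by norm_num) (by linarith [one_div_pos.2 this])

/-- Sums of increments over the ten cells of a decade. -/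
theorem sum_digit_sub (h : ℕ → ℝ) (i : Fin 9) (j : Fin 10) :
    ∑ k : Fin 10, (h (Triple.code (i, j, k) + 1) - h (Triple.code (i, j, k))) =
      h (100 * (i + 1) + 10 * (j + 1)) - h (100 * (i + 1) + 10 * j) := by
  have := Finset.sum_range_sub (fun k => h (100 * (i + 1) + 10 * j + k)) 10
  rw [Finset.sum_range] at this
  rw [mul_add 10, ← add_assoc, mul_one]
  exact this

theorem sum_triple_sub (h : ℕ → ℝ) :
    ∑ t : Triple, (h (t.code + 1) - h t.code) = h 1000 - h 100 := by
  have e1 : ∀ i : Fin 9, ∑ j : Fin 10, (h (100 * (i + 1) + 10 * (j + 1)) -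
      h (100 * (i + 1) + 10 * j)) = h (100 * (i + 2)) - h (100 * (i + 1)) := by
    intro i
    have := Finset.sum_range_sub (fun j => h (100 * (i + 1) + 10 * j)) 10
    rw [Finset.sum_range] at this
    rw [show 100 * ((i : ℕ) + 2) = 100 * (i + 1) + 10 * 10 by ring]
    exact this
  have e2 := Finset.sum_range_sub (fun i => h (100 * (i + 1))) 9
  rw [Finset.sum_range] at e2
  rw [Fintype.sum_prod_type]
  simp only [Fintype.sum_prod_type, sum_digit_sub, e1]
  exact e2

theorem sum_benford : ∑ t, benford t = 1 := by
  simp only [benford_eq_sub]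
  rw [sum_triple_sub, cellStart_thousand, cellStart_hundred, sub_zero]

theorem sum_empirical {b : ℝ} (hb : 0 < b) {N : ℕ} (hN : 1 ≤ N) : ∑ t, empirical b N t = 1 := by
  have hN0 : (N : ℝ) ≠ 0 := by positivity
  have h1 : ∑ t, (empirical b N - benford) t = 0 := by
    simp only [empirical_sub_benford_apply hb]
    have := sum_triple_sub (cellDiscr b N)
    -- The outer boundaries are 1 and 0, where all floors differ by exactly 1, so total mass is
    -- preserved.
    rw [cellDiscr, cellDiscr, cellStart_thousand, cellStart_hundred] at this
    simp only [sub_zero, Int.floor_sub_one, Int.cast_sub, Int.cast_one, Finset.sum_sub_distrib,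
      Finset.sum_const, Nat.card_Icc, nsmul_eq_mul, mul_one, add_tsub_cancel_right] at this
    rw [← neg_inj, ← Finset.sum_neg_distrib]
    simp only [neg_sub]
    rw [Finset.sum_sub_distrib, this, sub_div, div_self hN0]
    ring
  simp only [PiLp.sub_apply, Finset.sum_sub_distrib, sum_benford] at h1
  linarith

/-! ### Relative entropy on finite types -/

/-- `∑ q log (q / p)`, in nats. -/
noncomputable def relEntropy {ι : Type} [Fintype ι] (q p : ι → ℝ) : ℝ :=
  ∑ i, q i * (Real.log (q i) - Real.log (p i))

theorem sub_le_mul_log_sub {q p : ℝ} (hq : 0 ≤ q) (hp : 0 < p) :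
    q - p ≤ q * (Real.log q - Real.log p) := by
  rcases hq.eq_or_lt with rfl | hq
  · simp [hp.le]
  · have h := Real.log_le_sub_one_of_pos (div_pos hp hq)
    rw [Real.log_div hp.ne' hq.ne'] at h
    have h2 : q * (Real.log p - Real.log q) ≤ q * (p / q - 1) := by gcongr
    have h3 : q * (p / q - 1) = p - q := by field_simp
    linarith

theorem mul_log_sub_le {q p : ℝ} (hq : 0 ≤ q) (hp : 0 < p) :
    q * (Real.log q - Real.log p) ≤ (q - p) ^ 2 / p + (q - p) := by
  rcases hq.eq_or_lt with rfl | hq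
  · simp only [zero_mul, zero_sub, even_two, Even.neg_pow]
    rw [pow_two, mul_div_assoc, div_self hp.ne']
    simp
  · have h := Real.log_le_sub_one_of_pos (div_pos hq hp)
    rw [Real.log_div hq.ne' hp.ne'] at h
    have h2 : q * (Real.log q - Real.log p) ≤ q * (q / p - 1) := by gcongr
    have h3 : q * (q / p - 1) = (q - p) ^ 2 / p + (q - p) := by
      field_simp
      ring
    linarith

theorem relEntropy_nonneg {ι : Type} [Fintype ι] {q p : ι → ℝ} (hq : ∀ i, 0 ≤ q i)
    (hp : ∀ i, 0 < p i) (hsum : ∑ i, q i = ∑ i, p i) : 0 ≤ relEntropy q p := by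
  have h := Finset.sum_le_sum fun i (_ : i ∈ Finset.univ) => sub_le_mul_log_sub (hq i) (hp i)
  rw [Finset.sum_sub_distrib, hsum, sub_self] at h
  exact h

/-- The tangent-line bound `log x ≤ x - 1` at `x = q / p`; the first-order parts cancel because the
masses agree. -/
theorem relEntropy_le_chiSq {ι : Type} [Fintype ι] {q p : ι → ℝ} (hq : ∀ i, 0 ≤ q i)
    (hp : ∀ i, 0 < p i) (hsum : ∑ i, q i = ∑ i, p i) :
    relEntropy q p ≤ ∑ i, (q i - p i) ^ 2 / p i := by
  have h := Finset.sum_le_sum fun i (_ : i ∈ Finset.univ) => mul_log_sub_le (hq i) (hp i)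
  rw [Finset.sum_add_distrib, Finset.sum_sub_distrib, hsum, sub_self, add_zero] at h
  exact h

theorem entropy_sub_entropy {ι : Type} [Fintype ι] (q p : ι → ℝ) :
    entropy q - entropy p =
      (-relEntropy q p - ∑ i, (q i - p i) * Real.log (p i)) / Real.log 2 := by
  rw [entropy, entropy, relEntropy, ← sub_div, ← Finset.sum_sub_distrib, ← Finset.sum_neg_distrib,
    ← Finset.sum_sub_distrib]
  congr 1
  refine Finset.sum_congr rfl fun i _ => ?_
  simp only [Real.negMulLog]
  ring

/-! ### Marginals -/

/-- The marginal of `(D₁, D₂)`. -/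
def marg12 (p : TripleFun) (s : Fin 9 × Fin 10) : ℝ := ∑ k, p (s.1, s.2, k)

/-- The marginal of `(D₂, D₃)`. -/
def marg23 (p : TripleFun) (s : Fin 10 × Fin 10) : ℝ := ∑ i, p (i, s.1, s.2)

/-- The marginal of `D₂`. -/
def marg2 (p : TripleFun) (j : Fin 10) : ℝ := ∑ i, ∑ k, p (i, j, k)

theorem cmi_eq_entropy (p : TripleFun) : cmi p =
    entropy (marg12 p) - entropy (marg2 p) - (entropy (fun t => p t) - entropy (marg23 p)) := rfl

theorem marg12_sub (q p : TripleFun) (s) : marg12 (q - p) s = marg12 q s - marg12 p s := by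
  simp [marg12]

theorem marg23_sub (q p : TripleFun) (s) : marg23 (q - p) s = marg23 q s - marg23 p s := by
  simp [marg23]

theorem marg2_sub (q p : TripleFun) (s) : marg2 (q - p) s = marg2 q s - marg2 p s := by
  simp [marg2]

theorem sum_marg12_mul (p : TripleFun) (f : Fin 9 × Fin 10 → ℝ) :
    ∑ s, marg12 p s * f s = ∑ t : Triple, p t * f (t.1, t.2.1) := by
  simp only [marg12, Fintype.sum_prod_type, Finset.sum_mul]

theorem sum_marg23_mul (p : TripleFun) (f : Fin 10 × Fin 10 → ℝ) :
    ∑ s, marg23 p s * f s = ∑ t : Triple, p t * f t.2 := by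
  simp only [marg23, Finset.sum_mul]
  rw [Finset.sum_comm, ← Fintype.sum_prod_type']

theorem sum_marg2_mul (p : TripleFun) (f : Fin 10 → ℝ) :
    ∑ s, marg2 p s * f s = ∑ t : Triple, p t * f t.2.1 := by
  rw [Fintype.sum_prod_type]
  simp only [marg2, Fintype.sum_prod_type, Finset.sum_mul]
  rw [Finset.sum_comm]

theorem sum_marg12 (p : TripleFun) : ∑ s, marg12 p s = ∑ t, p t := by
  simpa using sum_marg12_mul p 1

theorem sum_marg23 (p : TripleFun) : ∑ s, marg23 p s = ∑ t, p t := by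
  simpa using sum_marg23_mul p 1

theorem sum_marg2 (p : TripleFun) : ∑ s, marg2 p s = ∑ t, p t := by
  simpa using sum_marg2_mul p 1

theorem marg12_pos {p : TripleFun} (hp : ∀ t, 0 < p t) (s) : 0 < marg12 p s :=
  Finset.sum_pos (fun _ _ => hp _) Finset.univ_nonempty

theorem marg23_pos {p : TripleFun} (hp : ∀ t, 0 < p t) (s) : 0 < marg23 p s :=
  Finset.sum_pos (fun _ _ => hp _) Finset.univ_nonempty

theorem marg2_pos {p : TripleFun} (hp : ∀ t, 0 < p t) (s) : 0 < marg2 p s :=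
  Finset.sum_pos (fun _ _ => Finset.sum_pos (fun _ _ => hp _) Finset.univ_nonempty)
    Finset.univ_nonempty

theorem marg12_nonneg {p : TripleFun} (hp : ∀ t, 0 ≤ p t) (s) : 0 ≤ marg12 p s :=
  Finset.sum_nonneg fun _ _ => hp _

theorem marg23_nonneg {p : TripleFun} (hp : ∀ t, 0 ≤ p t) (s) : 0 ≤ marg23 p s :=
  Finset.sum_nonneg fun _ _ => hp _

theorem marg2_nonneg {p : TripleFun} (hp : ∀ t, 0 ≤ p t) (s) : 0 ≤ marg2 p s :=
  Finset.sum_nonneg fun _ _ => Finset.sum_nonneg fun _ _ => hp _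

/-- The first-order term of `cmi` at `p`, in nats. -/
noncomputable def linTerm (p e : TripleFun) : ℝ :=
  ∑ t : Triple, e t * (Real.log (p t) + Real.log (marg2 p t.2.1) -
    Real.log (marg12 p (t.1, t.2.1)) - Real.log (marg23 p t.2))

/-- An exact identity: each entropy difference is minus a relative entropy plus a term linear in `q
- p`, and marginal linear terms pull back to triples. -/
theorem cmi_sub_cmi (q p : TripleFun) : cmi q - cmi p =
    (linTerm p (q - p) + (relEntropy (fun t => q t) (fun t => p t) +
      relEntropy (marg2 q) (marg2 p) - relEntropy (marg12 q) (marg12 p) -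
      relEntropy (marg23 q) (marg23 p))) / Real.log 2 := by
  have e0 := entropy_sub_entropy (fun t => q t) (fun t => p t)
  have e12 := entropy_sub_entropy (marg12 q) (marg12 p)
  have e2 := entropy_sub_entropy (marg2 q) (marg2 p)
  have e23 := entropy_sub_entropy (marg23 q) (marg23 p)
  simp only [← marg12_sub, sum_marg12_mul (q - p) (fun s => Real.log (marg12 p s))] at e12
  simp only [← marg2_sub, sum_marg2_mul (q - p) (fun s => Real.log (marg2 p s))] at e2
  simp only [← marg23_sub, sum_marg23_mul (q - p) (fun s => Real.log (marg23 p s))] at e23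
  have hl : linTerm p (q - p) = ∑ t : Triple, (q t - p t) * Real.log (p t) +
      ∑ t : Triple, (q - p) t * Real.log (marg2 p t.2.1) -
      ∑ t : Triple, (q - p) t * Real.log (marg12 p (t.1, t.2.1)) -
      ∑ t : Triple, (q - p) t * Real.log (marg23 p t.2) := by
    rw [linTerm, ← Finset.sum_add_distrib, ← Finset.sum_sub_distrib, ← Finset.sum_sub_distrib]
    refine Finset.sum_congr rfl fun t _ => ?_
    rw [PiLp.sub_apply]
    ring
  rw [cmi_eq_entropy, cmi_eq_entropy, hl]
  have : ∀ a b c d a' b' c' d' : ℝ, a - b - (c - d) - (a' - b' - (c' - d')) =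
    (a - a') - (b - b') - (c - c') + (d - d') := fun _ _ _ _ _ _ _ _ => by ring
  rw [this, e0, e12, e2, e23]
  ring

theorem cmi_sub_cmi_le {q p : TripleFun} (hq : ∀ t, 0 ≤ q t) (hp : ∀ t, 0 < p t)
    (hsum : ∑ t, q t = ∑ t, p t) : cmi q - cmi p ≤
      (linTerm p (q - p) + (∑ t, (q - p) t ^ 2 / p t +
        ∑ j, marg2 (q - p) j ^ 2 / marg2 p j)) / Real.log 2 := by
  rw [cmi_sub_cmi]
  have h0 := relEntropy_le_chiSq hq hp hsum
  have h2 := relEntropy_le_chiSq (marg2_nonneg hq) (marg2_pos hp)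
    (by rw [sum_marg2, sum_marg2, hsum])
  have h12 := relEntropy_nonneg (marg12_nonneg hq) (marg12_pos hp)
    (by rw [sum_marg12, sum_marg12, hsum])
  have h23 := relEntropy_nonneg (marg23_nonneg hq) (marg23_pos hp)
    (by rw [sum_marg23, sum_marg23, hsum])
  have := Real.log_pos one_lt_two
  simp only [marg2_sub, PiLp.sub_apply]
  gcongr
  linarith

theorem le_cmi_sub_cmi {q p : TripleFun} (hq : ∀ t, 0 ≤ q t) (hp : ∀ t, 0 < p t)
    (hsum : ∑ t, q t = ∑ t, p t) :
      (linTerm p (q - p) - (∑ s, marg12 (q - p) s ^ 2 / marg12 p s +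
        ∑ s, marg23 (q - p) s ^ 2 / marg23 p s)) / Real.log 2 ≤ cmi q - cmi p := by
  rw [cmi_sub_cmi]
  have h0 := relEntropy_nonneg hq hp hsum
  have h2 := relEntropy_nonneg (marg2_nonneg hq) (marg2_pos hp)
    (by rw [sum_marg2, sum_marg2, hsum])
  have h12 := relEntropy_le_chiSq (marg12_nonneg hq) (marg12_pos hp)
    (by rw [sum_marg12, sum_marg12, hsum])
  have h23 := relEntropy_le_chiSq (marg23_nonneg hq) (marg23_pos hp)
    (by rw [sum_marg23, sum_marg23, hsum])
  have := Real.log_pos one_lt_two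
  simp only [marg12_sub, marg23_sub]
  gcongr
  linarith

/-! ### Derivatives of the conditional mutual information -/

section Derivative

variable {ι E : Type} [Fintype ι] [NormedAddCommGroup E] [NormedSpace ℝ E]

/-- The derivative of `p ↦ entropy (Λ p)` for linear `Λ`. -/
noncomputable def entropyGrad (Λ : ι → E →L[ℝ] ℝ) (p : E) : E →L[ℝ] ℝ :=
  (Real.log 2)⁻¹ • ∑ i, (-Real.log (Λ i p) - 1) • Λ i

/-- The second derivative of `p ↦ entropy (Λ p)` for linear `Λ`. -/
noncomputable def entropyHess (Λ : ι → E →L[ℝ] ℝ) (p : E) : E →L[ℝ] E →L[ℝ] ℝ :=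
  (Real.log 2)⁻¹ • ∑ i, ((-(Λ i p)⁻¹) • Λ i).smulRight (Λ i)

theorem hasFDerivAt_entropy {Λ : ι → E →L[ℝ] ℝ} {p : E} (hp : ∀ i, Λ i p ≠ 0) :
    HasFDerivAt (fun p => entropy fun i => Λ i p) (entropyGrad Λ p) p := by
  have h : HasFDerivAt (fun p => ∑ i, Real.negMulLog (Λ i p))
      (∑ i, (-Real.log (Λ i p) - 1) • Λ i) p :=
    HasFDerivAt.fun_sum fun i _ =>
      (Real.hasDerivAt_negMulLog (hp i)).comp_hasFDerivAt p (Λ i).hasFDerivAt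
  have h2 := h.const_smul (Real.log 2)⁻¹
  refine h2.congr_of_eventuallyEq (Eventually.of_forall fun p => ?_)
  simp [entropy, div_eq_inv_mul]

theorem hasFDerivAt_entropyGrad {Λ : ι → E →L[ℝ] ℝ} {p : E} (hp : ∀ i, Λ i p ≠ 0) :
    HasFDerivAt (entropyGrad Λ) (entropyHess Λ p) p := by
  have h : HasFDerivAt (fun p => ∑ i, (-Real.log (Λ i p) - 1) • Λ i)
      (∑ i, ((-(Λ i p)⁻¹) • Λ i).smulRight (Λ i)) p := by
    refine HasFDerivAt.fun_sum fun i _ => ?_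
    have h1 := ((Real.hasDerivAt_log (hp i)).comp_hasFDerivAt p (Λ i).hasFDerivAt).neg.sub_const 1
    rw [← neg_smul] at h1
    exact h1.smul_const (Λ i)
  exact h.const_smul (Real.log 2)⁻¹

end Derivative

/-- Evaluation at a digit triple. -/
noncomputable def evalCLM (t : Triple) : TripleFun →L[ℝ] ℝ := EuclideanSpace.proj t

/-- `marg12` as a family of linear forms. -/
noncomputable def marg12CLM (s : Fin 9 × Fin 10) : TripleFun →L[ℝ] ℝ :=
  ∑ k, evalCLM (s.1, s.2, k)

/-- `marg23` as a family of linear forms. -/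
noncomputable def marg23CLM (s : Fin 10 × Fin 10) : TripleFun →L[ℝ] ℝ :=
  ∑ i, evalCLM (i, s.1, s.2)

/-- `marg2` as a family of linear forms. -/
noncomputable def marg2CLM (j : Fin 10) : TripleFun →L[ℝ] ℝ := ∑ i, ∑ k, evalCLM (i, j, k)

@[simp] theorem evalCLM_apply (t : Triple) (p : TripleFun) : evalCLM t p = p t := rfl

@[simp] theorem marg12CLM_apply (s) (p : TripleFun) : marg12CLM s p = marg12 p s := by
  simp [marg12CLM, marg12]

@[simp] theorem marg23CLM_apply (s) (p : TripleFun) : marg23CLM s p = marg23 p s := by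
  simp [marg23CLM, marg23]

@[simp] theorem marg2CLM_apply (s) (p : TripleFun) : marg2CLM s p = marg2 p s := by
  simp [marg2CLM, marg2]

/-- The derivative of `cmi` at laws with full support. -/
noncomputable def cmiGrad (p : TripleFun) : TripleFun →L[ℝ] ℝ :=
  entropyGrad marg12CLM p - entropyGrad marg2CLM p - (entropyGrad evalCLM p -
    entropyGrad marg23CLM p)

/-- The second derivative of `cmi` at laws with full support. -/
noncomputable def cmiHess (p : TripleFun) : TripleFun →L[ℝ] TripleFun →L[ℝ] ℝ :=
  entropyHess marg12CLM p - entropyHess marg2CLM p - (entropyHess evalCLM p -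
    entropyHess marg23CLM p)

theorem hasFDerivAt_cmi {p : TripleFun} (hp : ∀ t, 0 < p t) :
    HasFDerivAt cmi (cmiGrad p) p := by
  have h12 := hasFDerivAt_entropy (Λ := marg12CLM) (p := p)
    fun s => by simpa using (marg12_pos hp s).ne'
  have h23 := hasFDerivAt_entropy (Λ := marg23CLM) (p := p)
    fun s => by simpa using (marg23_pos hp s).ne'
  have h2 := hasFDerivAt_entropy (Λ := marg2CLM) (p := p)
    fun s => by simpa using (marg2_pos hp s).ne'
  have h0 := hasFDerivAt_entropy (Λ := evalCLM) (p := p) fun t => by simpa using (hp t).ne'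
  refine ((h12.sub h2).sub (h0.sub h23)).congr_of_eventuallyEq (Eventually.of_forall fun p => ?_)
  simp only [cmi_eq_entropy, Pi.sub_apply, marg12CLM_apply, marg23CLM_apply, marg2CLM_apply,
    evalCLM_apply]

theorem hasFDerivAt_cmiGrad {p : TripleFun} (hp : ∀ t, 0 < p t) :
    HasFDerivAt cmiGrad (cmiHess p) p := by
  have h12 := hasFDerivAt_entropyGrad (Λ := marg12CLM) (p := p)
    fun s => by simpa using (marg12_pos hp s).ne'
  have h23 := hasFDerivAt_entropyGrad (Λ := marg23CLM) (p := p)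
    fun s => by simpa using (marg23_pos hp s).ne'
  have h2 := hasFDerivAt_entropyGrad (Λ := marg2CLM) (p := p)
    fun s => by simpa using (marg2_pos hp s).ne'
  have h0 := hasFDerivAt_entropyGrad (Λ := evalCLM) (p := p) fun t => by simpa using (hp t).ne'
  exact (h12.sub h2).sub (h0.sub h23)

theorem fderiv_fderiv_cmi {p : TripleFun} (hp : ∀ t, 0 < p t) :
    fderiv ℝ (fderiv ℝ cmi) p = cmiHess p := by
  have hev : ∀ᶠ x : TripleFun in nhds p, ∀ t, 0 < x t :=
    eventually_all.2 fun t => (evalCLM t).continuous.continuousAt.eventually (lt_mem_nhds (hp t))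
  have : fderiv ℝ cmi =ᶠ[nhds p] cmiGrad := hev.mono fun x hx => (hasFDerivAt_cmi hx).fderiv
  rw [this.fderiv_eq, (hasFDerivAt_cmiGrad hp).fderiv]

/-- The constants `-1` in the four entropy gradients cancel, so this holds even for directions of
nonzero total mass. -/
theorem fderiv_cmi_apply {p e : TripleFun} (hp : ∀ t, 0 < p t) :
    fderiv ℝ cmi p e = linTerm p e / Real.log 2 := by
  have h12 := sum_marg12_mul e (fun s => -Real.log (marg12 p s) - 1)
  have h2 := sum_marg2_mul e (fun s => -Real.log (marg2 p s) - 1)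
  have h23 := sum_marg23_mul e (fun s => -Real.log (marg23 p s) - 1)
  rw [(hasFDerivAt_cmi hp).fderiv]
  simp only [cmiGrad, entropyGrad, sub_apply, smul_apply,
    sum_apply, marg12CLM_apply, marg23CLM_apply, marg2CLM_apply, evalCLM_apply,
    smul_eq_mul]
  simp only [mul_comm] at h12 h2 h23 ⊢
  rw [h12, h2, h23, div_eq_mul_inv, mul_comm _ (Real.log 2)⁻¹, ← mul_sub,
    ← mul_sub, ← mul_sub]
  congr 1
  rw [linTerm, ← Finset.sum_sub_distrib, ← Finset.sum_sub_distrib, ← Finset.sum_sub_distrib]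
  refine Finset.sum_congr rfl fun t _ => ?_
  ring

theorem cmiHess_apply_self (p v : TripleFun) : cmiHess p v v =
    (∑ t, v t ^ 2 / p t + ∑ j, marg2 v j ^ 2 / marg2 p j - ∑ s, marg12 v s ^ 2 / marg12 p s -
      ∑ s, marg23 v s ^ 2 / marg23 p s) / Real.log 2 := by
  have key : ∀ {ι : Type} [Fintype ι] (Λ : ι → TripleFun →L[ℝ] ℝ),
      entropyHess Λ p v v = -(∑ i, Λ i v ^ 2 / Λ i p) / Real.log 2 := by
    intro ι _ Λ
    simp only [entropyHess, smul_apply, sum_apply,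
      ContinuousLinearMap.smulRight_apply, smul_eq_mul, div_eq_inv_mul,
      ← Finset.sum_neg_distrib]
    congr 1
    refine Finset.sum_congr rfl fun i _ => ?_
    ring
  simp only [cmiHess, sub_apply, key, marg12CLM_apply, marg23CLM_apply,
    marg2CLM_apply, evalCLM_apply]
  ring

/-! ### Numerical bounds for the Benford law -/

theorem log_ten_pos : 0 < Real.log 10 := Real.log_pos (by norm_num)

theorem benford_le (t : Triple) : benford t ≤ (1 / t.code) / Real.log 10 := by
  have h : (0 : ℝ) < t.code := by exact_mod_cast (by linarith [t.hundred_le_code] : 0 < t.code)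
  rw [benford_apply, Real.logb]
  have := log_ten_pos
  gcongr
  have := Real.log_le_sub_one_of_pos (by positivity : (0 : ℝ) < 1 + 1 / t.code)
  linarith

theorem two_div_le_log_one_add_inv {x : ℝ} (hx : 0 < x) : 2 / (2 * x + 1) ≤ Real.log (1 + 1 / x) := by
  have := Real.le_log_one_add_of_nonneg (one_div_pos.2 hx).le
  have e : 2 * (1 / x) / (1 / x + 2) = 2 / (2 * x + 1) := by
    field_simp
    ring
  rwa [e] at this

theorem le_benford (t : Triple) : (2 / (2 * t.code + 1)) / Real.log 10 ≤ benford t := by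
  have h : (0 : ℝ) < t.code := by exact_mod_cast (by linarith [t.hundred_le_code] : 0 < t.code)
  rw [benford_apply, Real.logb]
  have := log_ten_pos
  gcongr
  exact two_div_le_log_one_add_inv h

theorem inv_benford_le (t : Triple) : 1 / benford t ≤ Real.log 10 * (t.code + 1 / 2) := by
  have := log_ten_pos
  calc 1 / benford t ≤ 1 / ((2 / (2 * t.code + 1)) / Real.log 10) := by
        gcongr
        exact le_benford t
    _ = Real.log 10 * (t.code + 1 / 2) := by field_simp

/-- The ten cells of a decade telescope to one cell of the two-digit Benford law. -/
theorem marg12_benford (s : Fin 9 × Fin 10) :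
    marg12 benford s = Real.logb 10 (1 + 1 / (10 * (s.1 + 1) + s.2)) := by
  have h0 : (0 : ℝ) < 10 * (s.1 + 1) + s.2 := by positivity
  simp only [marg12, benford_eq_sub]
  rw [sum_digit_sub, cellStart, cellStart, ← Real.logb_div (by positivity) (by positivity)]
  congr 1
  push_cast
  rw [show (100 : ℝ) * (s.1 + 1) + 10 * s.2 = 10 * (10 * (s.1 + 1) + s.2) by ring]
  field_simp
  ring

theorem inv_marg2_benford_le (j : Fin 10) : 1 / marg2 benford j ≤ Real.log 10 * (39 / 2) := by
  have := log_ten_pos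
  -- Only leading digit 1 is kept; the worst two-digit number is 19, and `39 = 2 * 19 + 1`.
  have h1 : (2 / 39) / Real.log 10 ≤ marg2 benford j := by
    have h2 : marg12 benford (0, j) ≤ marg2 benford j :=
      Finset.single_le_sum (f := fun i : Fin 9 => marg12 benford (i, j))
        (fun i _ => (marg12_pos benford_pos (i, j)).le) (Finset.mem_univ 0)
    refine le_trans ?_ h2
    have hj : (j : ℝ) ≤ 9 := by exact_mod_cast (by omega : (j : ℕ) ≤ 9)
    rw [marg12_benford, Real.logb]
    gcongr
    refine le_trans ?_ (two_div_le_log_one_add_inv (by positivity))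
    gcongr
    simp only [Fin.val_zero]
    push_cast
    linarith
  calc 1 / marg2 benford j ≤ 1 / ((2 / 39) / Real.log 10) := by gcongr
    _ = Real.log 10 * (39 / 2) := by field_simp

theorem sum_inv_benford_le : ∑ t, 1 / benford t ≤ Real.log 10 * 495000 := by
  calc ∑ t, 1 / benford t ≤ ∑ t : Triple, Real.log 10 * (t.code + 1 / 2) :=
        Finset.sum_le_sum fun t _ => inv_benford_le t
    _ = Real.log 10 * 495000 := by
        rw [← Finset.mul_sum]
        congr 1
        have : ∑ t : Triple, ((t.code : ℝ) + 1 / 2) =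
            ((1000 : ℕ) : ℝ) ^ 2 / 2 - ((100 : ℕ) : ℝ) ^ 2 / 2 := by
          rw [← sum_triple_sub (fun δ => (δ : ℝ) ^ 2 / 2)]
          refine Finset.sum_congr rfl fun t _ => ?_
          push_cast
          ring
        rw [this]
        norm_num

/-! ### A lower bound for the Hessian -/

/-- The direction `e₉₉₉ - e₉₉₈`. -/
noncomputable def lastCellsDiff : TripleFun :=
  WithLp.toLp 2 fun t : Triple => if t = (8, 9, 9) then 1 else if t = (8, 9, 8) then -1 else 0

theorem marg12_lastCellsDiff (s) : marg12 lastCellsDiff s = 0 := by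
  obtain ⟨i, j⟩ := s
  by_cases h : i = 8 ∧ j = 9
  · obtain ⟨rfl, rfl⟩ := h
    rw [marg12, Fintype.sum_eq_add 8 9 (by decide)]
    · simp [lastCellsDiff]
    · rintro k ⟨h8, h9⟩
      simp [lastCellsDiff, h8, h9]
  · refine Finset.sum_eq_zero fun k _ => ?_
    simp only [lastCellsDiff, Prod.mk.injEq]
    rw [if_neg (fun hh => h ⟨hh.1, hh.2.1⟩), if_neg (fun hh => h ⟨hh.1, hh.2.1⟩)]

theorem marg23_lastCellsDiff (s) :
    marg23 lastCellsDiff s = if s = (9, 9) then 1 else if s = (9, 8) then -1 else 0 := by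
  rw [marg23, Fintype.sum_eq_single 8]
  · simp [lastCellsDiff, Prod.ext_iff]
  · intro i hi
    simp [lastCellsDiff, hi]

/-- The direction `e₉₉₉ - e₉₉₈` lives on two of the rarest triples, whose reciprocals are large, and
has zero `(D₁, D₂)` marginal. Only the `(D₂, D₃)` marginal subtracts, at most `2 * 52`: `999 + 998 -
104 = 1893`, divided by `‖v‖² = 2` and halved. -/
theorem hessConst_ge : 1893 / 4 * (Real.log 10 / Real.log 2) ≤ hessConst := by
  have hl := log_ten_pos
  have hl2 := Real.log_pos one_lt_two
  set v := lastCellsDiff with hv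
  have hnorm : ‖v‖ ^ 2 = 2 := by
    rw [EuclideanSpace.norm_sq_eq, Fintype.sum_eq_add (8, 9, 9) (8, 9, 8) (by decide)]
    · simp [hv, lastCellsDiff]
      norm_num
    · rintro t ⟨h1, h2⟩
      simp [hv, lastCellsDiff, h1, h2]
  have h0 : ∑ t, v t ^ 2 / benford t = 1 / benford (8, 9, 9) + 1 / benford (8, 9, 8) := by
    rw [Fintype.sum_eq_add (8, 9, 9) (8, 9, 8) (by decide)]
    · simp [hv, lastCellsDiff]
    · rintro t ⟨h1, h2⟩
      simp [hv, lastCellsDiff, h1, h2]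
  have h23 : ∑ s, marg23 v s ^ 2 / marg23 benford s =
      1 / marg23 benford (9, 9) + 1 / marg23 benford (9, 8) := by
    simp only [hv, marg23_lastCellsDiff]
    rw [Fintype.sum_eq_add (9, 9) (9, 8) (by decide)]
    · simp
    · rintro t ⟨h1, h2⟩
      simp [h1, h2]
  have h12 : ∑ s, marg12 v s ^ 2 / marg12 benford s = 0 :=
    Finset.sum_eq_zero fun s _ => by simp [hv, marg12_lastCellsDiff]
  have h2 : 0 ≤ ∑ j, marg2 v j ^ 2 / marg2 benford j :=
    Finset.sum_nonneg fun j _ => div_nonneg (sq_nonneg _) (marg2_pos benford_pos j).le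
  have hH := cmiHess_apply_self benford v
  rw [h0, h23, h12] at hH
  have b1 : Real.log 10 * 999 ≤ 1 / benford (8, 9, 9) := by
    rw [le_one_div (by positivity) (benford_pos _)]
    refine (benford_le _).trans (le_of_eq ?_)
    norm_num [Triple.code]
    field_simp
  have b2 : Real.log 10 * 998 ≤ 1 / benford (8, 9, 8) := by
    rw [le_one_div (by positivity) (benford_pos _)]
    refine (benford_le _).trans (le_of_eq ?_)
    norm_num [Triple.code]
    field_simp
  have b3 : ∀ k : Fin 10, 1 / marg23 benford (9, k) ≤ Real.log 10 * 52 := by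
    intro k
    have h3 : (1 / 52) / Real.log 10 ≤ marg23 benford (9, k) := by
      calc (1 / 52) / Real.log 10
          ≤ (∑ i : Fin 9, (2 / (200 * (i + 1) + 199) : ℝ)) / Real.log 10 := by
            gcongr
            simp [Fin.sum_univ_succ]
            norm_num
        _ ≤ marg23 benford (9, k) := by
            rw [Finset.sum_div, marg23]
            refine Finset.sum_le_sum fun i _ => le_trans ?_ (le_benford _)
            have hk : (k : ℝ) ≤ 9 := by exact_mod_cast (by omega : (k : ℕ) ≤ 9)
            have h9 : (((9 : Fin 10) : ℕ) : ℝ) = 9 := by norm_num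
            simp only [Triple.code]
            push_cast
            rw [h9]
            refine div_le_div_of_nonneg_right ?_ hl.le
            refine div_le_div_of_nonneg_left (by norm_num) (by positivity) ?_
            linarith
    calc 1 / marg23 benford (9, k) ≤ 1 / ((1 / 52) / Real.log 10) := by gcongr
      _ = Real.log 10 * 52 := by field_simp
  have hlow : Real.log 10 * 1893 / Real.log 2 ≤ cmiHess benford v v := by
    rw [hH]
    gcongr
    linarith [b3 9, b3 8]
  have hup : cmiHess benford v v ≤ ‖cmiHess benford‖ * ‖v‖ ^ 2 := by
    refine (le_abs_self _).trans ?_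
    have := (cmiHess benford).le_opNorm₂ v v
    rwa [mul_assoc, ← pow_two] at this
  rw [hnorm] at hup
  rw [hessConst, fderiv_fderiv_cmi benford_pos]
  have : Real.log 10 * 1893 / Real.log 2 = 1893 * (Real.log 10 / Real.log 2) := by ring
  linarith

/-! ### The first-order term -/

theorem abs_mul_le_of_abs_le {c x E : ℝ} (hc : 0 ≤ c) (hx : |x| ≤ E) :
    -(c * E) ≤ c * x ∧ c * x ≤ c * E := by
  obtain ⟨h1, h2⟩ := abs_le.1 hx
  exact ⟨by rw [← mul_neg]; gcongr, by gcongr⟩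

/-- Summation by parts over one decade. -/
theorem abs_sum_sub_mul_le {f : Fin 10 → ℝ} (hf : Antitone f) (h4 : 0 ≤ f 4) (h5 : f 5 ≤ 0)
    {H : ℕ → ℝ} {E : ℝ} (hH : ∀ m n, |H m - H n| ≤ E) :
    |∑ k : Fin 10, (H k - H (k + 1)) * f k| ≤ E * (f 0 - f 9) := by
  have hd : ∀ m n : Fin 10, m ≤ n → 0 ≤ f m - f n := fun m n h => sub_nonneg.2 (hf h)
  have a0 := abs_mul_le_of_abs_le (hd 0 1 (by decide)) (hH 0 1)
  have a1 := abs_mul_le_of_abs_le (hd 1 2 (by decide)) (hH 0 2)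
  have a2 := abs_mul_le_of_abs_le (hd 2 3 (by decide)) (hH 0 3)
  have a3 := abs_mul_le_of_abs_le (hd 3 4 (by decide)) (hH 0 4)
  have a4 := abs_mul_le_of_abs_le h4 (hH 0 5)
  have a5 := abs_mul_le_of_abs_le (neg_nonneg.2 h5) (hH 10 5)
  have a6 := abs_mul_le_of_abs_le (hd 5 6 (by decide)) (hH 10 6)
  have a7 := abs_mul_le_of_abs_le (hd 6 7 (by decide)) (hH 10 7)
  have a8 := abs_mul_le_of_abs_le (hd 7 8 (by decide)) (hH 10 8)
  have a9 := abs_mul_le_of_abs_le (hd 8 9 (by decide)) (hH 10 9)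
  -- Abel summation anchored at `H 0` where `f ≥ 0` and at `H 10` where `f ≤ 0`: all coefficients
  -- are nonnegative and total `f 0 - f 9`.
  have e : ∑ k : Fin 10, (H k - H (k + 1)) * f k =
      (f 0 - f 1) * (H 0 - H 1) + (f 1 - f 2) * (H 0 - H 2) + (f 2 - f 3) * (H 0 - H 3) +
      (f 3 - f 4) * (H 0 - H 4) + f 4 * (H 0 - H 5) + -f 5 * (H 10 - H 5) +
      (f 5 - f 6) * (H 10 - H 6) + (f 6 - f 7) * (H 10 - H 7) + (f 7 - f 8) * (H 10 - H 8) +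
      (f 8 - f 9) * (H 10 - H 9) := by
    have e' : ∑ k : Fin 10, (H k - H (k + 1)) * f k =
        ∑ k ∈ Finset.range 10, (H k - H (k + 1)) * f (Fin.ofNat 10 k) := by
      rw [Finset.sum_range]
      refine Finset.sum_congr rfl fun k _ => ?_
      simp
    rw [e']
    simp only [Finset.sum_range_succ, Finset.sum_range_zero]
    change 0 + (H 0 - H 1) * f 0 + (H 1 - H 2) * f 1 + (H 2 - H 3) * f 2 + (H 3 - H 4) * f 3 +
      (H 4 - H 5) * f 4 + (H 5 - H 6) * f 5 + (H 6 - H 7) * f 6 + (H 7 - H 8) * f 7 +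
      (H 8 - H 9) * f 8 + (H 9 - H 10) * f 9 = _
    ring
  rw [e, abs_le]
  constructor <;> linarith [a0.1, a0.2, a1.1, a1.2, a2.1, a2.2, a3.1, a3.2, a4.1, a4.2, a5.1, a5.2,
    a6.1, a6.2, a7.1, a7.2, a8.1, a8.2, a9.1, a9.2]

theorem benford_antitone (i : Fin 9) (j : Fin 10) : Antitone fun k => benford (i, j, k) := by
  intro k l hkl
  have h0 : (0 : ℝ) < Triple.code (i, j, k) := by
    exact_mod_cast (by linarith [Triple.hundred_le_code (i, j, k)] : 0 < Triple.code (i, j, k))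
  have h1 : (Triple.code (i, j, k) : ℝ) ≤ Triple.code (i, j, l) := by
    exact_mod_cast (by simp only [Triple.code]; omega : Triple.code (i, j, k) ≤ Triple.code (i, j, l))
  simp only [benford_apply]
  exact Real.logb_le_logb_of_le (by norm_num) (by positivity) (by gcongr)

/-- With `ten_mul_benford_le_marg12`, this places the mean of a decade between its values at digits
4 and 5, the sign change needed for the summation by parts. The terms of `(1 + x) ^ 10` up to degree
2 suffice since `5 D ≥ 16`. -/
theorem marg12_le_ten_mul_benford (i : Fin 9) (j : Fin 10) :
    marg12 benford (i, j) ≤ 10 * benford (i, j, 4) := by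
  have hpow := Real.logb_pow 10 (1 + 1 / (Triple.code (i, j, 4) : ℝ)) 10
  push_cast at hpow
  rw [marg12_benford, benford_apply, ← hpow]
  refine Real.logb_le_logb_of_le (by norm_num) (by positivity) ?_
  have e : ((Triple.code (i, j, 4) : ℕ) : ℝ) = 10 * (10 * ((i : ℝ) + 1) + j) + 4 := by
    simp only [Triple.code]
    push_cast
    norm_num
    ring
  rw [e]
  have hD : (10 : ℝ) ≤ 10 * ((i : ℝ) + 1) + j := by
    have : (0 : ℝ) ≤ i := by positivity
    have : (0 : ℝ) ≤ j := by positivity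
    linarith
  set D : ℝ := 10 * ((i : ℝ) + 1) + j
  have hx : 0 ≤ 1 / (10 * D + 4) := by positivity
  set x := 1 / (10 * D + 4) with hxd
  have h1 : 1 + 1 / D ≤ 1 + 10 * x + 45 * x ^ 2 := by
    have : 10 * x + 45 * x ^ 2 - 1 / D = (5 * D - 16) / (D * (10 * D + 4) ^ 2) := by
      rw [hxd]
      field_simp
      ring
    have h2 : 0 ≤ (5 * D - 16) / (D * (10 * D + 4) ^ 2) :=
      div_nonneg (by linarith) (by positivity)
    linarith
  have h3 : 1 + 10 * x + 45 * x ^ 2 ≤ (1 + x) ^ 10 := by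
    have : (1 + x) ^ 10 = 1 + 10 * x + 45 * x ^ 2 + x ^ 3 * (120 + 210 * x + 252 * x ^ 2 +
      210 * x ^ 3 + 120 * x ^ 4 + 45 * x ^ 5 + 10 * x ^ 6 + x ^ 7) := by ring
    rw [this]
    have : 0 ≤ x ^ 3 * (120 + 210 * x + 252 * x ^ 2 +
      210 * x ^ 3 + 120 * x ^ 4 + 45 * x ^ 5 + 10 * x ^ 6 + x ^ 7) := by positivity
    linarith
  exact h1.trans h3

theorem ten_mul_benford_le_marg12 (i : Fin 9) (j : Fin 10) :
    10 * benford (i, j, 5) ≤ marg12 benford (i, j) := by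
  have hD : (0 : ℝ) < 10 * ((i : ℝ) + 1) + j := by positivity
  have e : ((Triple.code (i, j, 5) : ℕ) : ℝ) = 10 * (10 * ((i : ℝ) + 1) + j) + 5 := by
    simp only [Triple.code]
    push_cast
    norm_num
    ring
  have h := benford_le (i, j, 5)
  rw [e] at h
  rw [marg12_benford, Real.logb]
  set D : ℝ := 10 * ((i : ℝ) + 1) + j
  calc 10 * benford (i, j, 5) ≤ 10 * ((1 / (10 * D + 5)) / Real.log 10) := by gcongr
    _ = (2 / (2 * D + 1)) / Real.log 10 := by
        rw [← mul_div_assoc]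
        congr 1
        field_simp
        ring
    _ ≤ _ := by
        have := log_ten_pos
        gcongr
        exact two_div_le_log_one_add_inv hD

theorem log_div_antitone {f : Fin 10 → ℝ} (hf : Antitone f) (hpos : ∀ k, 0 < f k) (m : ℝ) :
    Antitone fun k => Real.log (10 * f k) - Real.log m := fun k l hkl => by
  have := hpos l
  have := hf hkl
  simp only
  gcongr

/-- Summation by parts for the logarithm of a decreasing law on ten digits, relative to its mean. -/
theorem abs_sum_sub_mul_log_le {f : Fin 10 → ℝ} (hf : Antitone f) (hpos : ∀ k, 0 < f k) {m : ℝ}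
    (hm : 0 < m) (h4 : m ≤ 10 * f 4) (h5 : 10 * f 5 ≤ m)
    {H : ℕ → ℝ} {E : ℝ} (hH : ∀ m n, |H m - H n| ≤ E) :
    |∑ k : Fin 10, (H k - H (k + 1)) * (Real.log (10 * f k) - Real.log m)| ≤
      E * (Real.log (f 0) - Real.log (f 9)) := by
  have h := abs_sum_sub_mul_le (log_div_antitone hf hpos m)
    (sub_nonneg.2 (Real.log_le_log hm h4))
    (sub_nonpos.2 (Real.log_le_log (mul_pos (by norm_num) (hpos 5)) h5)) hH
  rwa [sub_sub_sub_cancel_right, Real.log_mul (by norm_num) (hpos 0).ne',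
    Real.log_mul (by norm_num) (hpos 9).ne', add_sub_add_left_eq_sub] at h

theorem log_benford_sub_le (i : Fin 9) (j : Fin 10) :
    Real.log (benford (i, j, 0)) - Real.log (benford (i, j, 9)) ≤
      19 / (20 * (10 * ((i : ℝ) + 1) + j)) := by
  have hD : (0 : ℝ) < 10 * ((i : ℝ) + 1) + j := by positivity
  have e0 : ((Triple.code (i, j, 0) : ℕ) : ℝ) = 10 * (10 * ((i : ℝ) + 1) + j) := by
    simp only [Triple.code]
    push_cast
    norm_num
    ring
  have e9 : ((Triple.code (i, j, 9) : ℕ) : ℝ) = 10 * (10 * ((i : ℝ) + 1) + j) + 9 := by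
    simp only [Triple.code]
    push_cast
    norm_num
    ring
  have h0 := benford_le (i, j, 0)
  have h9 := le_benford (i, j, 9)
  have p0 := benford_pos (i, j, 0)
  have p9 := benford_pos (i, j, 9)
  have hl := log_ten_pos
  rw [e0] at h0
  rw [e9] at h9
  set D : ℝ := 10 * ((i : ℝ) + 1) + j
  rw [← Real.log_div p0.ne' p9.ne']
  refine (Real.log_le_sub_one_of_pos (div_pos p0 p9)).trans ?_
  have : benford (i, j, 0) / benford (i, j, 9) ≤
      (1 / (10 * D)) / Real.log 10 / ((2 / (2 * (10 * D + 9) + 1)) / Real.log 10) := by gcongr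
  have e : (1 / (10 * D)) / Real.log 10 / ((2 / (2 * (10 * D + 9) + 1)) / Real.log 10) =
      1 + 19 / (20 * D) := by
    field_simp
    ring
  linarith

theorem log_marg23_benford_sub_le (j : Fin 10) :
    Real.log (marg23 benford (j, 0)) - Real.log (marg23 benford (j, 9)) ≤
      1 / (19 + 9 / 5 * (j : ℝ)) := by
  have hl := log_ten_pos
  have h0 : marg23 benford (j, 0) ≤
      (∑ i : Fin 9, (1 / (100 * (i + 1) + 10 * j) : ℝ)) / Real.log 10 := by
    rw [Finset.sum_div, marg23]
    refine Finset.sum_le_sum fun i _ => (benford_le _).trans (le_of_eq ?_)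
    simp [Triple.code]
  have h9 : (∑ i : Fin 9, (2 / (200 * (i + 1) + 20 * j + 19) : ℝ)) / Real.log 10 ≤
      marg23 benford (j, 9) := by
    rw [Finset.sum_div, marg23]
    refine Finset.sum_le_sum fun i _ => le_trans (le_of_eq ?_) (le_benford _)
    have h9 : (((9 : Fin 10) : ℕ) : ℝ) = 9 := by norm_num
    simp only [Triple.code]
    push_cast
    rw [h9]
    congr 2
    ring
  -- The right-hand side is a simple majorant of the ratio of the two sums; it is checked as a
  -- rational inequality for each of the ten digits `j`.
  have hc : (∑ i : Fin 9, (1 / (100 * (i + 1) + 10 * j) : ℝ)) ≤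
      (1 + 1 / (19 + 9 / 5 * (j : ℝ))) * ∑ i : Fin 9, (2 / (200 * (i + 1) + 20 * j + 19) : ℝ) := by
    fin_cases j <;> simp [Fin.sum_univ_succ] <;> norm_num
  have p0 := marg23_pos benford_pos (j, 0)
  have p9 := marg23_pos benford_pos (j, 9)
  rw [← Real.log_div p0.ne' p9.ne']
  refine (Real.log_le_sub_one_of_pos (div_pos p0 p9)).trans ?_
  rw [sub_le_iff_le_add', div_le_iff₀ p9]
  calc marg23 benford (j, 0) ≤ _ := h0
    _ ≤ ((1 + 1 / (19 + 9 / 5 * (j : ℝ))) *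
        ∑ i : Fin 9, (2 / (200 * (i + 1) + 20 * j + 19) : ℝ)) / Real.log 10 := by gcongr
    _ ≤ _ := by
        rw [mul_div_assoc]
        gcongr

theorem sum_log_benford_sub_le : ∑ i : Fin 9, ∑ j : Fin 10,
    (Real.log (benford (i, j, 0)) - Real.log (benford (i, j, 9))) ≤ 2.24 := by
  calc _ ≤ ∑ i : Fin 9, ∑ j : Fin 10, (19 / (20 * (10 * ((i : ℝ) + 1) + j)) : ℝ) :=
        Finset.sum_le_sum fun i _ => Finset.sum_le_sum fun j _ => log_benford_sub_le i j
    _ ≤ 2.24 := by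
        simp [Fin.sum_univ_succ]
        norm_num

theorem sum_log_marg23_benford_sub_le : ∑ j : Fin 10,
    (Real.log (marg23 benford (j, 0)) - Real.log (marg23 benford (j, 9))) ≤ 0.395 := by
  calc _ ≤ ∑ j : Fin 10, (1 / (19 + 9 / 5 * (j : ℝ)) : ℝ) :=
        Finset.sum_le_sum fun j _ => log_marg23_benford_sub_le j
    _ ≤ 0.395 := by
        simp [Fin.sum_univ_succ]
        norm_num

/-- The first-order term at the Benford law is small for differences of small discrepancy. -/
theorem abs_linTerm_benford_le {e : TripleFun} {h : ℕ → ℝ} {E : ℝ} (hE : 0 ≤ E)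
    (he : ∀ t : Triple, e t = h t.code - h (t.code + 1)) (hh : ∀ m n, |h m - h n| ≤ E) :
    |linTerm benford e| ≤ 5.8 * E := by
  -- The weight is the log-ratio of a cell to its decade mean, minus the same ratio for the `(D₂,
  -- D₃)` marginal; the factors 10 cancel.
  have hsplit : linTerm benford e = ∑ i : Fin 9, ∑ j : Fin 10,
      (∑ k : Fin 10, e (i, j, k) * (Real.log (10 * benford (i, j, k)) -
        Real.log (marg12 benford (i, j))) -
      ∑ k : Fin 10, e (i, j, k) * (Real.log (10 * marg23 benford (j, k)) -
        Real.log (marg2 benford j))) := by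
    simp only [linTerm, Fintype.sum_prod_type, ← Finset.sum_sub_distrib]
    refine Finset.sum_congr rfl fun i _ => Finset.sum_congr rfl fun j _ =>
      Finset.sum_congr rfl fun k _ => ?_
    rw [Real.log_mul (by norm_num) (benford_pos _).ne',
      Real.log_mul (by norm_num) (marg23_pos benford_pos _).ne']
    ring
  have hek : ∀ i j (k : Fin 10), e (i, j, k) =
      h (100 * ((i : ℕ) + 1) + 10 * j + k) - h (100 * ((i : ℕ) + 1) + 10 * j + (k + 1)) :=
    fun i j k => he (i, j, k)
  have h1 : ∀ i j, |∑ k : Fin 10, e (i, j, k) * (Real.log (10 * benford (i, j, k)) -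
      Real.log (marg12 benford (i, j)))| ≤
      E * (Real.log (benford (i, j, 0)) - Real.log (benford (i, j, 9))) := by
    intro i j
    simp only [hek]
    exact abs_sum_sub_mul_log_le (benford_antitone i j) (fun k => benford_pos _)
      (marg12_pos benford_pos _) (marg12_le_ten_mul_benford i j) (ten_mul_benford_le_marg12 i j)
      (H := fun k => h (100 * ((i : ℕ) + 1) + 10 * j + k)) fun m n => hh _ _
  have h2 : ∀ (i : Fin 9) j, |∑ k : Fin 10, e (i, j, k) *
      (Real.log (10 * marg23 benford (j, k)) - Real.log (marg2 benford j))| ≤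
      E * (Real.log (marg23 benford (j, 0)) - Real.log (marg23 benford (j, 9))) := by
    intro i j
    simp only [hek]
    refine abs_sum_sub_mul_log_le (f := fun k => marg23 benford (j, k))
      (fun k l hkl => Finset.sum_le_sum fun i _ => benford_antitone i j hkl)
      (fun k => marg23_pos benford_pos _) (marg2_pos benford_pos _) ?_ ?_
      (H := fun k => h (100 * ((i : ℕ) + 1) + 10 * j + k)) fun m n => hh _ _
    · rw [marg23, Finset.mul_sum]
      exact Finset.sum_le_sum fun i _ => marg12_le_ten_mul_benford i j
    · rw [marg23, Finset.mul_sum]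
      exact Finset.sum_le_sum fun i _ => ten_mul_benford_le_marg12 i j
  rw [hsplit]
  calc _ ≤ ∑ i : Fin 9, ∑ j : Fin 10,
        (E * (Real.log (benford (i, j, 0)) - Real.log (benford (i, j, 9))) +
          E * (Real.log (marg23 benford (j, 0)) - Real.log (marg23 benford (j, 9)))) := by
        refine (Finset.abs_sum_le_sum_abs _ _).trans (Finset.sum_le_sum fun i _ => ?_)
        refine (Finset.abs_sum_le_sum_abs _ _).trans (Finset.sum_le_sum fun j _ => ?_)
        exact (abs_sub _ _).trans (add_le_add (h1 i j) (h2 i j))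
    _ = E * (∑ i : Fin 9, ∑ j : Fin 10,
          (Real.log (benford (i, j, 0)) - Real.log (benford (i, j, 9)))) +
        9 * (E * ∑ j : Fin 10,
          (Real.log (marg23 benford (j, 0)) - Real.log (marg23 benford (j, 9)))) := by
        simp only [Finset.sum_add_distrib, ← Finset.mul_sum]
        simp
        ring
    -- The second sum does not depend on `i`, hence the 9; the total is `5.795 E`.
    _ ≤ E * 2.24 + 9 * (E * 0.395) := by
        gcongr
        · exact sum_log_benford_sub_le
        · exact sum_log_marg23_benford_sub_le
    _ ≤ 5.8 * E := by linarith

/-! ### Second-order terms -/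

theorem abs_sum_le_card_mul {ι : Type} [Fintype ι] {f : ι → ℝ} {E : ℝ} (h : ∀ i, |f i| ≤ E) :
    |∑ i, f i| ≤ Fintype.card ι * E := by
  refine (Finset.abs_sum_le_sum_abs _ _).trans ((Finset.sum_le_sum fun i _ => h i).trans ?_)
  simp

theorem sum_sq_div_le {ι : Type} [Fintype ι] {f p : ι → ℝ} {E : ℝ} (h : ∀ i, |f i| ≤ E)
    (hp : ∀ i, 0 < p i) : ∑ i, f i ^ 2 / p i ≤ E ^ 2 * ∑ i, 1 / p i := by
  rw [Finset.mul_sum]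
  refine Finset.sum_le_sum fun i _ => ?_
  have := hp i
  rw [mul_one_div]
  gcongr ?_ / _
  exact sq_le_sq' (neg_le_of_abs_le (h i)) (le_of_abs_le (h i))

/-- Since the entries lie in `[0, 1]`, `(q - p)² ≤ q + p`, which sums to 2. This is independent of
the discrepancy and serves for small `N`. -/
theorem sum_sub_sq_div_le {ι : Type} [Fintype ι] {q p : ι → ℝ} {C : ℝ} (hq : ∀ i, 0 ≤ q i)
    (hp : ∀ i, 0 < p i) (hqs : ∑ i, q i = 1) (hps : ∑ i, p i = 1) (hC : ∀ i, 1 / p i ≤ C) :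
    ∑ i, (q i - p i) ^ 2 / p i ≤ C * 2 := by
  have h1 : ∀ i, (q i - p i) ^ 2 / p i ≤ C * (q i + p i) := by
    intro i
    have q1 : q i ≤ 1 := hqs ▸ Finset.single_le_sum (fun i _ => hq i) (Finset.mem_univ i)
    have p1 : p i ≤ 1 := hps ▸ Finset.single_le_sum (fun i _ => (hp i).le) (Finset.mem_univ i)
    have hqi := hq i
    have hpi := hp i
    have h2 : (q i - p i) ^ 2 ≤ q i + p i := by nlinarith
    rw [div_eq_mul_one_div, mul_comm]
    have := hC i
    have : 0 < 1 / p i := by positivity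
    have : 0 ≤ C := by linarith
    gcongr
  refine (Finset.sum_le_sum fun i _ => h1 i).trans (le_of_eq ?_)
  rw [← Finset.mul_sum, Finset.sum_add_distrib, hqs, hps]
  norm_num

section Discrepancy

variable {e : TripleFun} {h : ℕ → ℝ} {E : ℝ}

theorem abs_apply_le (he : ∀ t : Triple, e t = h t.code - h (t.code + 1))
    (hh : ∀ m n, |h m - h n| ≤ E) (t : Triple) : |e t| ≤ E := he t ▸ hh _ _

theorem abs_marg12_le (he : ∀ t : Triple, e t = h t.code - h (t.code + 1))
    (hh : ∀ m n, |h m - h n| ≤ E) (s) : |marg12 e s| ≤ E := by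
  have : marg12 e s = -∑ k : Fin 10, (h (Triple.code (s.1, s.2, k) + 1) -
      h (Triple.code (s.1, s.2, k))) := by
    rw [marg12, ← Finset.sum_neg_distrib]
    exact Finset.sum_congr rfl fun k _ => by rw [he, neg_sub]
  rw [this, sum_digit_sub, abs_neg]
  exact hh _ _

theorem abs_marg23_le (he : ∀ t : Triple, e t = h t.code - h (t.code + 1))
    (hh : ∀ m n, |h m - h n| ≤ E) (s) : |marg23 e s| ≤ 9 * E := by
  simpa [marg23] using abs_sum_le_card_mul fun i => abs_apply_le he hh (i, s.1, s.2)

theorem abs_marg2_le (he : ∀ t : Triple, e t = h t.code - h (t.code + 1))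
    (hh : ∀ m n, |h m - h n| ≤ E) (j) : |marg2 e j| ≤ 9 * E := by
  simpa [marg2, marg12] using abs_sum_le_card_mul fun i => abs_marg12_le he hh (i, j)

theorem norm_sq_le (he : ∀ t : Triple, e t = h t.code - h (t.code + 1))
    (hh : ∀ m n, |h m - h n| ≤ E) : ‖e‖ ^ 2 ≤ 900 * E ^ 2 := by
  rw [EuclideanSpace.norm_sq_eq]
  calc ∑ t, ‖e t‖ ^ 2 ≤ ∑ _t : Triple, E ^ 2 := Finset.sum_le_sum fun t _ => by
        have := abs_apply_le he hh t
        rw [Real.norm_eq_abs]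
        gcongr
    _ = 900 * E ^ 2 := by simp

/-- `510795 = 495000 + 81 * 195`, where 81 is the square of the 9 leading digits summed in the `D₂`
marginal. -/
theorem chiSq_le (he : ∀ t : Triple, e t = h t.code - h (t.code + 1))
    (hh : ∀ m n, |h m - h n| ≤ E) :
    ∑ t, e t ^ 2 / benford t + ∑ j, marg2 e j ^ 2 / marg2 benford j ≤
      Real.log 10 * 510795 * E ^ 2 := by
  have h1 := sum_sq_div_le (abs_apply_le he hh) benford_pos
  have h2 := sum_sq_div_le (abs_marg2_le he hh) (marg2_pos benford_pos)
  have h3 : E ^ 2 * ∑ t, 1 / benford t ≤ E ^ 2 * (Real.log 10 * 495000) := by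
    gcongr
    exact sum_inv_benford_le
  have h4 : (9 * E) ^ 2 * ∑ j, 1 / marg2 benford j ≤ (9 * E) ^ 2 * (Real.log 10 * 195) := by
    gcongr
    refine (Finset.sum_le_sum fun j _ => inv_marg2_benford_le j).trans (le_of_eq ?_)
    simp
    ring
  linarith

end Discrepancy

/-! ### The empirical conditional mutual information -/

/-- The bound on the discrepancy over the cells. -/
noncomputable def discrBound (M : ℝ) (N : ℕ) : ℝ := M * (Real.logb 2 N + 1) / N

section Empirical

variable {b M : ℝ} {N : ℕ}

theorem log_two_mul_discrBound_le (hM : 1 ≤ M) (hN : 2 ≤ N) :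
    Real.log 2 * discrBound M N ≤ 2 * (M * Real.log N / N) := by
  have hl2 := Real.log_pos one_lt_two
  have hN0 : (0 : ℝ) < N := by positivity
  have h1 : Real.log 2 ≤ Real.log N := Real.log_le_log (by norm_num) (by exact_mod_cast hN)
  have e : Real.log 2 * discrBound M N = M * (Real.log N + Real.log 2) / N := by
    rw [discrBound, Real.logb]
    field_simp
  rw [e, ← mul_div_assoc]
  refine div_le_div_of_nonneg_right ?_ hN0.le
  nlinarith

theorem log_two_mul_discrBound_le_of_sixteen_le (hM : 1 ≤ M) (hN : 16 ≤ N) :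
    Real.log 2 * discrBound M N ≤ 5 / 4 * (M * Real.log N / N) := by
  have hl2 := Real.log_pos one_lt_two
  have hN0 : (0 : ℝ) < N := by positivity
  have h1 : 4 * Real.log 2 ≤ Real.log N := by
    have : Real.log ((2 : ℝ) ^ 4) ≤ Real.log N :=
      Real.log_le_log (by norm_num) (by norm_num; exact_mod_cast hN)
    rw [Real.log_pow] at this
    exact_mod_cast this
  have e : Real.log 2 * discrBound M N = M * (Real.log N + Real.log 2) / N := by
    rw [discrBound, Real.logb]
    field_simp
  rw [e, ← mul_div_assoc]
  refine div_le_div_of_nonneg_right ?_ hN0.le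
  nlinarith

theorem discrBound_nonneg (hM : 1 ≤ M) (hN : 1 ≤ N) : 0 ≤ discrBound M N := by
  have : 0 ≤ Real.logb 2 N := Real.logb_nonneg (by norm_num) (by exact_mod_cast hN)
  rw [discrBound]
  positivity

theorem empirical_sub_le (hb : 0 < b) (hα : Irrational (Real.logb 10 b))
    (hM : PartialQuotientsLE (Real.logb 10 b) M) (hN : 1 ≤ N) :
    empiricalCMI b N - limitCMI ≤ (linTerm benford (empirical b N - benford) +
      Real.log 10 * 510795 * discrBound M N ^ 2) / Real.log 2 := by
  refine (cmi_sub_cmi_le (empirical_nonneg b N) benford_pos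
    (by rw [sum_empirical hb hN, sum_benford])).trans ?_
  have := Real.log_pos one_lt_two
  gcongr
  exact chiSq_le (empirical_sub_benford_apply hb N) (abs_cellDiscr_sub_le hα hM hN)

theorem empirical_sub_le_crude (hb : 0 < b) (hN : 1 ≤ N) :
    empiricalCMI b N - limitCMI ≤ (linTerm benford (empirical b N - benford) +
      Real.log 10 * 2038) / Real.log 2 := by
  have hsum : ∑ t, empirical b N t = ∑ t, benford t := by rw [sum_empirical hb hN, sum_benford]
  refine (cmi_sub_cmi_le (empirical_nonneg b N) benford_pos hsum).trans ?_
  have hl2 := Real.log_pos one_lt_two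
  have hl := log_ten_pos
  have h0 := sum_sub_sq_div_le (empirical_nonneg b N) benford_pos (sum_empirical hb hN) sum_benford
    (C := Real.log 10 * 999.5) fun t => (inv_benford_le t).trans (by
      have : (t.code : ℝ) ≤ 999 := by exact_mod_cast Nat.le_of_lt_succ t.code_lt
      gcongr
      linarith)
  have h2 := sum_sub_sq_div_le (marg2_nonneg (empirical_nonneg b N)) (marg2_pos benford_pos)
    (by rw [sum_marg2, sum_empirical hb hN]) (by rw [sum_marg2, sum_benford]) inv_marg2_benford_le
  simp only [marg2_sub, PiLp.sub_apply]
  gcongr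
  linarith

theorem abs_linTerm_empirical_le (hb : 0 < b) (hα : Irrational (Real.logb 10 b))
    (hM : PartialQuotientsLE (Real.logb 10 b) M) (hN : 1 ≤ N) :
    |linTerm benford (empirical b N - benford)| ≤ 5.8 * discrBound M N :=
  abs_linTerm_benford_le (discrBound_nonneg (one_le_of_partialQuotientsLE hα hM) hN)
    (empirical_sub_benford_apply hb N) (abs_cellDiscr_sub_le hα hM hN)

theorem rate_bound (hb : 0 < b) (hα : Irrational (Real.logb 10 b))
    (hM : PartialQuotientsLE (Real.logb 10 b) M) (hN : 2 ≤ N) :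
    empiricalCMI b N - limitCMI ≤ rateConst₁ * (M * Real.log N / N) +
      rateConst₂ * (M ^ 2 * Real.log N ^ 2 / (N : ℝ) ^ 2) := by
  have hM1 := one_le_of_partialQuotientsLE hα hM
  have hN0 : (0 : ℝ) < N := by positivity
  have hE0 := discrBound_nonneg hM1 (by omega : 1 ≤ N)
  have hlin := (le_abs_self _).trans (abs_linTerm_empirical_le hb hα hM (by omega : 1 ≤ N))
  have hl2 : 0.6931 ≤ Real.log 2 := by linarith [Real.log_two_gt_d9]
  have hl20 : 0 < Real.log 2 := by linarith
  have hl10 := log_ten_pos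
  have hlN : Real.log 2 ≤ Real.log N := Real.log_le_log (by norm_num) (by exact_mod_cast hN)
  have hH := hessConst_ge
  have hx2 : M ^ 2 * Real.log N ^ 2 / (N : ℝ) ^ 2 = (M * Real.log N / N) ^ 2 := by ring
  have hx0 : 0 ≤ M * Real.log N / N := by positivity
  have hd := log_two_mul_discrBound_le hM1 hN
  have hd' := log_two_mul_discrBound_le_of_sixteen_le (N := N) hM1
  have hup := empirical_sub_le hb hα hM (by omega : 1 ≤ N)
  have hcr := empirical_sub_le_crude hb (by omega : 1 ≤ N)
  -- `log 2 / 15 > 0.0433`.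
  have hxlow : N < 16 → 0.0433 ≤ M * Real.log N / N := by
    intro h16
    rw [le_div_iff₀ hN0]
    have : (N : ℝ) ≤ 15 := by exact_mod_cast Nat.le_of_lt_succ h16
    nlinarith
  rw [hx2, rateConst₁, rateConst₂]
  set x := M * Real.log N / N
  set E := discrBound M N
  set r := Real.log 10 / Real.log 2 with hr
  have hr1 : 1 ≤ r := by
    rw [hr, one_le_div hl20]
    exact Real.log_le_log (by norm_num) (by norm_num)
  have hHx : 1893 / 4 * r * 3600 * x ^ 2 ≤ hessConst * 3600 * x ^ 2 := by gcongr
  refine le_trans ?_ (add_le_add_right hHx _)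
  -- For `N ≥ 16`, `log₂ N + 1 ≤ (5/4) log₂ N` gives `E ≤ 1.8035 x`, and `510795 * 1.8035² < 3600 *
  -- 1893 / 4`. For smaller `N` the factor 2 in place of 5/4 would overshoot; there `x` is bounded
  -- below, so the crude bound and the excess `24.2 - 16.8` of the linear coefficient are absorbed
  -- by the `x²` term.
  rcases Nat.lt_or_ge N 16 with h16 | h16
  · have hx := hxlow h16
    have hE : E ≤ 2.886 * x := by nlinarith
    have h1 : empiricalCMI b N - limitCMI ≤ 5.8 * E / Real.log 2 + r * 2038 := by
      refine hcr.trans ?_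
      rw [hr, div_mul_eq_mul_div, ← add_div]
      gcongr
    have h2 : 5.8 * E / Real.log 2 ≤ 24.2 * x := by
      rw [div_le_iff₀ hl20]
      nlinarith
    have h3 : 0.00187 ≤ x ^ 2 := by nlinarith
    have h4 : 7.4 * x ≤ 171 * x ^ 2 := by nlinarith
    have h5 : x ^ 2 ≤ r * x ^ 2 := by nlinarith
    have h6 : r * 0.00187 ≤ r * x ^ 2 := by gcongr
    linarith
  · have hE : E ≤ 1.8035 * x := by
      have := hd' h16
      nlinarith
    have h1 : empiricalCMI b N - limitCMI ≤ 5.8 * E / Real.log 2 + r * 510795 * E ^ 2 := by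
      refine hup.trans ?_
      rw [hr, div_mul_eq_mul_div, div_mul_eq_mul_div, ← add_div]
      gcongr
    have h2 : 5.8 * E / Real.log 2 ≤ 16.8 * x := by
      rw [div_le_iff₀ hl20]
      nlinarith
    have h3 : r * 510795 * E ^ 2 ≤ r * 510795 * (1.8035 * x) ^ 2 := by gcongr
    have h4 : 0 ≤ r * x ^ 2 := by positivity
    linarith

/-- The linear term is exactly the derivative at `P`; what remains are four relative entropies, each
at most a constant times `E²`. The constant involves only the Benford law. -/
theorem exists_abs_sub_fderiv_le : ∃ C : ℝ, 0 < C ∧ ∀ (b M : ℝ) (N : ℕ), 0 < b →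
    Irrational (Real.logb 10 b) → PartialQuotientsLE (Real.logb 10 b) M → 1 ≤ N →
    |empiricalCMI b N - limitCMI - fderiv ℝ cmi benford (empirical b N - benford)| ≤
      C * discrBound M N ^ 2 := by
  set C₁ := ∑ s, 1 / marg12 benford s with hC₁
  set C₂ := ∑ s, 1 / marg23 benford s with hC₂
  have hC₁0 : 0 ≤ C₁ := Finset.sum_nonneg fun s _ => (one_div_pos.2 (marg12_pos benford_pos s)).le
  have hC₂0 : 0 ≤ C₂ := Finset.sum_nonneg fun s _ => (one_div_pos.2 (marg23_pos benford_pos s)).le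
  have hl2 := Real.log_pos one_lt_two
  have hl10 := log_ten_pos
  refine ⟨(Real.log 10 * 510795 + (C₁ + 81 * C₂)) / Real.log 2, by positivity,
    fun b M N hb hα hM hN => ?_⟩
  have he := empirical_sub_benford_apply hb N
  have hh := abs_cellDiscr_sub_le hα hM hN
  have hup := empirical_sub_le hb hα hM hN
  have hlow := le_cmi_sub_cmi (empirical_nonneg b N) benford_pos
    (by rw [sum_empirical hb hN, sum_benford])
  have h12 := sum_sq_div_le (abs_marg12_le he hh) (marg12_pos benford_pos)
  have h23 := sum_sq_div_le (abs_marg23_le he hh) (marg23_pos benford_pos)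
  rw [← hC₁] at h12
  rw [← hC₂] at h23
  rw [fderiv_cmi_apply benford_pos]
  change _ ≤ empiricalCMI b N - limitCMI at hlow
  rw [← discrBound] at h12 h23
  set E := discrBound M N
  set L := linTerm benford (empirical b N - benford)
  have h1 : (L - (C₁ + 81 * C₂) * E ^ 2) / Real.log 2 ≤ empiricalCMI b N - limitCMI := by
    refine le_trans ?_ hlow
    gcongr
    linarith
  have e1 : (L - (C₁ + 81 * C₂) * E ^ 2) / Real.log 2 =
      L / Real.log 2 - (C₁ + 81 * C₂) / Real.log 2 * E ^ 2 := by ring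
  have e2 : (L + Real.log 10 * 510795 * E ^ 2) / Real.log 2 =
      L / Real.log 2 + Real.log 10 * 510795 / Real.log 2 * E ^ 2 := by ring
  have p1 : 0 ≤ (C₁ + 81 * C₂) / Real.log 2 * E ^ 2 := by positivity
  have p2 : 0 ≤ Real.log 10 * 510795 / Real.log 2 * E ^ 2 := by positivity
  rw [add_div, add_mul, abs_le]
  constructor <;> linarith

theorem discrBound_sq_le (hM : 1 ≤ M) (hN : 2 ≤ N) :
    discrBound M N ^ 2 ≤ (2 / Real.log 2) ^ 2 * (M ^ 2 * Real.log N ^ 2 / (N : ℝ) ^ 2) := by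
  have hl2 := Real.log_pos one_lt_two
  have h0 := discrBound_nonneg hM (by omega : 1 ≤ N)
  have h1 : discrBound M N ≤ 2 / Real.log 2 * (M * Real.log N / N) := by
    rw [div_mul_eq_mul_div, le_div_iff₀ hl2, mul_comm]
    exact log_two_mul_discrBound_le hM hN
  calc discrBound M N ^ 2 ≤ (2 / Real.log 2 * (M * Real.log N / N)) ^ 2 := by gcongr
    _ = _ := by ring

/-- Quadratic scaling in either form gives the quadratic rate. -/
theorem exists_abs_sub_le_of_quadraticScaling (K : ℝ) (hK : 0 < K) : ∃ C : ℝ, 0 < C ∧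
    ∀ (b M : ℝ) (N : ℕ), 0 < b → Irrational (Real.logb 10 b) →
    PartialQuotientsLE (Real.logb 10 b) M → 2 ≤ N →
    QuadraticScaling K b N ∨ LinearTermSuppressed K b N →
    |empiricalCMI b N - limitCMI| ≤ C * (M ^ 2 * Real.log N ^ 2 / (N : ℝ) ^ 2) := by
  obtain ⟨C, hC, hbd⟩ := exists_abs_sub_fderiv_le
  have hl2 := Real.log_pos one_lt_two
  refine ⟨(900 * K + C) * (2 / Real.log 2) ^ 2, by positivity, fun b M N hb hα hM hN hs => ?_⟩
  have hM1 := one_le_of_partialQuotientsLE hα hM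
  have hn := norm_sq_le (empirical_sub_benford_apply hb N)
    (abs_cellDiscr_sub_le hα hM (by omega : 1 ≤ N))
  rw [← discrBound] at hn
  have hE := discrBound_sq_le hM1 hN
  have hKn : K * ‖empirical b N - benford‖ ^ 2 ≤ 900 * K * discrBound M N ^ 2 := by nlinarith
  have hmain : |empiricalCMI b N - limitCMI| ≤ (900 * K + C) * discrBound M N ^ 2 := by
    have hCE : 0 ≤ C * discrBound M N ^ 2 := by positivity
    rcases hs with hs | hs
    · have := hs.trans hKn
      linarith
    · have h1 := hs.trans hKn
      have h2 := hbd b M N hb hα hM (by omega)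
      have h3 := abs_sub_abs_le_abs_sub (empiricalCMI b N - limitCMI)
        (fderiv ℝ cmi benford (empirical b N - benford))
      linarith
  refine hmain.trans ?_
  rw [mul_assoc]
  gcongr

theorem exists_abs_sub_le_log_div (hb : 0 < b) (hα : Irrational (Real.logb 10 b))
    (hM : PartialQuotientsLE (Real.logb 10 b) M) : ∃ C : ℝ, ∀ N : ℕ, 2 ≤ N →
      |empiricalCMI b N - limitCMI| ≤ C * (Real.log N / N) := by
  obtain ⟨C, hC, hbd⟩ := exists_abs_sub_fderiv_le
  have hl2 := Real.log_pos one_lt_two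
  have hM1 := one_le_of_partialQuotientsLE hα hM
  refine ⟨(5.8 / Real.log 2 + C * (2 / Real.log 2 * M)) * (2 / Real.log 2 * M), fun N hN => ?_⟩
  have hN0 : (0 : ℝ) < N := by positivity
  have h1 := hbd b M N hb hα hM (by omega)
  have h2 := abs_linTerm_empirical_le hb hα hM (by omega : 1 ≤ N)
  have h3 : |fderiv ℝ cmi benford (empirical b N - benford)| ≤
      5.8 / Real.log 2 * discrBound M N := by
    rw [fderiv_cmi_apply benford_pos, abs_div, abs_of_pos hl2, div_mul_eq_mul_div]
    gcongr
  have h4 := abs_sub_abs_le_abs_sub (empiricalCMI b N - limitCMI)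
    (fderiv ℝ cmi benford (empirical b N - benford))
  have h5 : discrBound M N ≤ 2 / Real.log 2 * M * (Real.log N / N) := by
    rw [mul_assoc, ← mul_div_assoc M, div_mul_eq_mul_div, le_div_iff₀ hl2, mul_comm]
    exact log_two_mul_discrBound_le hM1 hN
  -- Bounds `E` by a constant, so that one factor of `E²` is absorbed; the resulting constant may
  -- depend on `M`.
  have h6 : Real.log N / N ≤ 1 := by
    rw [div_le_one hN0]
    exact (Real.log_le_sub_one_of_pos hN0).trans (by linarith)
  have h0 := discrBound_nonneg hM1 (by omega : 1 ≤ N)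
  have h7 : discrBound M N ≤ 2 / Real.log 2 * M := by
    refine h5.trans (mul_le_of_le_one_right (by positivity) h6)
  calc |empiricalCMI b N - limitCMI|
      ≤ 5.8 / Real.log 2 * discrBound M N + C * discrBound M N ^ 2 := by linarith
    _ = (5.8 / Real.log 2 + C * discrBound M N) * discrBound M N := by ring
    _ ≤ (5.8 / Real.log 2 + C * (2 / Real.log 2 * M)) * (2 / Real.log 2 * M * (Real.log N / N)) := by
        gcongr
    _ = _ := by ring

end Empirical

/-! ### Decay exponents and assembly. -/

theorem log_pow_div_pow_isBigO (k : ℕ) {ε : ℝ} (hε : 0 < ε) :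
    (fun N : ℕ => Real.log N ^ k / (N : ℝ) ^ k) =O[atTop] fun N : ℕ => (N : ℝ) ^ (-(k : ℝ) + ε) := by
  have h := ((isLittleO_log_rpow_rpow_atTop (k : ℝ) hε).comp_tendsto
    tendsto_natCast_atTop_atTop).isBigO.mul
    (isBigO_refl (fun N : ℕ => ((N : ℝ) ^ k)⁻¹) atTop)
  refine h.congr' (Eventually.of_forall fun N => ?_) ?_
  · simp [div_eq_mul_inv]
  · filter_upwards [eventually_gt_atTop 0] with N hN
    have : (0 : ℝ) < N := by exact_mod_cast hN
    simp only [Function.comp]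
    rw [add_comm, Real.rpow_add this, Real.rpow_neg this.le, Real.rpow_natCast]

theorem theorem3p7 :
    -- (a)
    (∀ b : ℝ, 0 < b → Irrational (Real.logb 10 b) →
      ∀ M : ℝ, PartialQuotientsLE (Real.logb 10 b) M →
        (∀ N : ℕ, 2 ≤ N →
          empiricalCMI b N - limitCMI ≤
            rateConst₁ * (M * Real.log N / N) +
              rateConst₂ * (M ^ 2 * Real.log N ^ 2 / (N : ℝ) ^ 2)) ∧
        ((fun N : ℕ => empiricalCMI b N - limitCMI) =O[atTop]
          fun N : ℕ => Real.log N / (N : ℝ)) ∧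
        (∀ ε : ℝ, 0 < ε →
          (fun N : ℕ => empiricalCMI b N - limitCMI) =O[atTop]
            fun N : ℕ => (N : ℝ) ^ (-1 + ε))) ∧
    -- (b), the bound, with `C_U` depending only on the constant `K` of the quadratic scaling
    (∀ K : ℝ, 0 < K → ∃ C_U : ℝ, 0 < C_U ∧
      ∀ b : ℝ, 0 < b → Irrational (Real.logb 10 b) →
        ∀ M : ℝ, PartialQuotientsLE (Real.logb 10 b) M →
          ∀ N : ℕ, 2 ≤ N → QuadraticScaling K b N ∨ LinearTermSuppressed K b N →
            empiricalCMI b N - limitCMI ≤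
              C_U * (M ^ 2 * Real.log N ^ 2 / (N : ℝ) ^ 2)) ∧
    -- (b), the decay exponent, along any set `S` of sample sizes with quadratic scaling
    (∀ b : ℝ, 0 < b → Irrational (Real.logb 10 b) →
      ∀ M : ℝ, PartialQuotientsLE (Real.logb 10 b) M →
        ∀ (S : Set ℕ) (K : ℝ), 0 < K →
          (∀ᶠ N in atTop ⊓ 𝓟 S, QuadraticScaling K b N ∨ LinearTermSuppressed K b N) →
            ((fun N : ℕ => empiricalCMI b N - limitCMI) =O[atTop ⊓ 𝓟 S]
              fun N : ℕ => Real.log N ^ 2 / (N : ℝ) ^ 2) ∧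
            (∀ ε : ℝ, 0 < ε →
              (fun N : ℕ => empiricalCMI b N - limitCMI) =O[atTop ⊓ 𝓟 S]
                fun N : ℕ => (N : ℝ) ^ (-2 + ε))) := by
  refine ⟨fun b hb hα M hM => ?_, fun K hK => ?_, fun b hb hα M hM S K hK hs => ?_⟩
  · have hO : (fun N : ℕ => empiricalCMI b N - limitCMI) =O[atTop]
        fun N : ℕ => Real.log N / (N : ℝ) := by
      obtain ⟨C, hC⟩ := exists_abs_sub_le_log_div hb hα hM
      refine IsBigO.of_bound C ?_
      filter_upwards [eventually_ge_atTop 2] with N hN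
      rw [Real.norm_eq_abs, Real.norm_of_nonneg (by positivity)]
      exact hC N hN
    refine ⟨fun N hN => rate_bound hb hα hM hN, hO, fun ε hε => hO.trans ?_⟩
    simpa using log_pow_div_pow_isBigO 1 hε
  · obtain ⟨C, hC, hbd⟩ := exists_abs_sub_le_of_quadraticScaling K hK
    exact ⟨C, hC, fun b hb hα M hM N hN hs =>
      (le_abs_self _).trans (hbd b M N hb hα hM hN hs)⟩
  · have hO : (fun N : ℕ => empiricalCMI b N - limitCMI) =O[atTop ⊓ 𝓟 S]
        fun N : ℕ => Real.log N ^ 2 / (N : ℝ) ^ 2 := by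
      obtain ⟨C, hC, hbd⟩ := exists_abs_sub_le_of_quadraticScaling K hK
      refine IsBigO.of_bound (C * M ^ 2) ?_
      filter_upwards [hs, (eventually_ge_atTop 2).filter_mono inf_le_left] with N hsN hN
      rw [Real.norm_eq_abs, Real.norm_of_nonneg (by positivity), mul_assoc, ← mul_div_assoc]
      exact hbd b M N hb hα hM hN hsN
    refine ⟨hO, fun ε hε => hO.trans (IsBigO.mono ?_ inf_le_left)⟩
    simpa using log_pow_div_pow_isBigO 2 hε
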